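/- Let $q\ge 1$ and $N\ge1$ be integers. Let $P=(p_{ij})_{i,j=1}^N$ be an irreducible row-stochastic matrix such that for every $i$ there are at least two $j$ with $p_{ij}>0$. Call a finite word $\sigma=\sigma_1\cdots\sigma_k$ over $\{1,\dots,N\}$ admissible if $p_{\sigma_h\sigma_{h+1}}>0$ for $1\le h<k$ (the empty word and all words of length one are admissible), and let $G_\infty$ be the set of infinite sequences $\omega$ with $p_{\omega_h\omega_{h+1}}>0$ for all $h\ge 1$. For $i,j$ with $p_{ij}>0$ let $c_{ij}\in(0,1)$, and put $c_\sigma=c_{\sigma_1\sigma_2}\cdots c_{\sigma_{k-1}\sigma_k}$ ($c_\sigma=1$ if $k=1$). Let $J_1,\dots,J_N\subset\mathbb R^q$ be non-empty compact sets, each the closure of its interior. For every non-empty admissible word $\sigma$ and every $j$ with $\sigma j$ admissible let $J_{\sigma j}\subset J_\sigma$ be the image of $J_j$ under a similarity of $\mathbb R^q$ with ratio $c_{\sigma j}$, such that the interiors of $J_{\sigma i}$ and $J_{\sigma j}$ are disjoint for $i\neq j$. Write $|A|$ for the diameter of $A$ and $d(A,B)$ for the distance of two sets. Assume that there is a constant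 $0<t<1$ such that for every admissible word $\sigma$ (the empty word included) and all $i\ne j$ with $\sigma i,\sigma j$ admissible, $$d(J_{\sigma i},J_{\sigma j})\ge t\max\{|J_{\sigma i}|,|J_{\sigma j}|\}.$$ (Similarities, diameters and distances of sets are taken with respect to a fixed norm on $\mathbb R^q$, for example the Euclidean one.) Let $(q_i)_{i=1}^N$ be any probability vector with $q_i>0$ for all $i$. Let $\widetilde\mu$ be the Markov measure on $G_\infty$ that gives the set of sequences starting with the admissible word $\sigma_1\cdots\sigma_k$, $k\ge1$, the mass $q_{\sigma_1}p_{\sigma_1\sigma_2}\cdots p_{\sigma_{k-1}\sigma_k}$. Let $g(\omega)$ be the unique point of $\bigcap_{k\ge1}J_{\omega_1\cdots\omega_k}$, and let $\mu=\widetilde\mu\circ g^{-1}$. For an arbitrary norm on $\mathbb R^q$, let $d(x,\alpha)$ denote the distance from $x$ to the set $\alpha$ in that norm, let $$e_n(\mu)=\inf\Big\{\exp\int\log d(x,\alpha)\,d\mu(x):\ \alpha\subset\mathbb R^q,\ 1\le\operatorname{card}\alpha\le n\Big\}$$ be the $n$th geometric mean error (with $\log 0=-\infty$ and $\exp(-\infty)=0$),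 and let $$\underline D_0(\mu)=\liminf_{n\to\infty}\frac{\log n}{-\log e_n(\mu)},\quad \overline D_0(\mu)=\limsup_{n\to\infty}\frac{\log n}{-\log e_n(\mu)},\quad \underline Q_0^s(\mu)=\liminf_{n\to\infty}n^{1/s}e_n(\mu),\quad \overline Q_0^s(\mu)=\limsup_{n\to\infty}n^{1/s}e_n(\mu).$$ Let $v=(v_i)_{i=1}^N$ be the positive left eigenvector of $P$ for the eigenvalue $1$ with $\sum_i v_i=1$, and let $$s_0=\frac{\sum_{i=1}^N v_i\sum_{j:\,p_{ij}>0}p_{ij}\log p_{ij}}{\sum_{i=1}^N v_i\sum_{j:\,p_{ij}>0}p_{ij}\log c_{ij}}.$$ Then the quantization dimension of order zero exists and equals $s_0$, that is, $\underline D_0(\mu)=\overline D_0(\mu)=s_0$, and $$0<\underline Q_0^{s_0}(\mu)\le\overline Q_0^{s_0}(\mu)<\infty .$$ In particular the quantization dimension of order zero of $\mu$ does not depend on the initial vector $(q_i)_{i=1}^N$. -/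

import Mathlib

open MeasureTheory Filter
open scoped ENNReal

noncomputable section

namespace GeoQuant

/-! ### Quantization with respect to the geometric mean error -/

section Quantization

variable {E : Type*} [NormedAddCommGroup E] [NormedSpace ℝ E] [MeasurableSpace E]

/-- The distance `d(x, α)` from `x` to a finite set `α`, in the metric induced by the norm `nm`. -/
def setDist (nm : Seminorm ℝ E) (α : Finset E) (x : E) : ℝ≥0∞ :=
  ⨅ a ∈ α, ENNReal.ofReal (nm (x - a))

/-- `∫ log d(x, α) dν(x)` as an extended real number: the integral of the positive part minus the
integral of the negative part, where `log 0 = -∞`. -/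
def meanLog (nm : Seminorm ℝ E) (ν : Measure E) (α : Finset E) : EReal :=
  ((∫⁻ x, (ENNReal.log (setDist nm α x)).toENNReal ∂ν : ℝ≥0∞) : EReal) -
    ((∫⁻ x, (-ENNReal.log (setDist nm α x)).toENNReal ∂ν : ℝ≥0∞) : EReal)

/-- The `n`th quantization error of order zero (`n`th geometric mean error) of `ν`: the infimum of
`exp ∫ log d(x, α) dν(x)` over all sets `α` with `1 ≤ card α ≤ n`. -/
def geomError (nm : Seminorm ℝ E) (ν : Measure E) (n : ℕ) : ℝ≥0∞ :=
  ⨅ (α : Finset E) (_ : 1 ≤ α.card ∧ α.card ≤ n), EReal.exp (meanLog nm ν α)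

/-- The upper quantization dimension of order zero. -/
def upperDim (nm : Seminorm ℝ E) (ν : Measure E) : EReal :=
  limsup (fun n : ℕ => ((Real.log n : ℝ) : EReal) / (-ENNReal.log (geomError nm ν n))) atTop

/-- The lower quantization dimension of order zero. -/
def lowerDim (nm : Seminorm ℝ E) (ν : Measure E) : EReal :=
  liminf (fun n : ℕ => ((Real.log n : ℝ) : EReal) / (-ENNReal.log (geomError nm ν n))) atTop

/-- The `s`-dimensional upper quantization coefficient of order zero. -/
def upperCoeff (nm : Seminorm ℝ E) (s : ℝ) (ν : Measure E) : ℝ≥0∞ :=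
  limsup (fun n : ℕ => (n : ℝ≥0∞) ^ (1 / s) * geomError nm ν n) atTop

/-- The `s`-dimensional lower quantization coefficient of order zero. -/
def lowerCoeff (nm : Seminorm ℝ E) (s : ℝ) (ν : Measure E) : ℝ≥0∞ :=
  liminf (fun n : ℕ => (n : ℝ≥0∞) ^ (1 / s) * geomError nm ν n) atTop

end Quantization

/-! ### Words, Mauldin–Williams fractals and Markov-type measures -/

section Words

variable {N : ℕ}

/-- `Admissible P σ` says that `σ` belongs to `G^*`: all transitions in the word `σ` have positive
probability. The empty word and the words of length one are admissible. -/
def Admissible (P : Matrix (Fin N) (Fin N) ℝ) (σ : List (Fin N)) : Prop :=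
  σ.IsChain (fun i j => 0 < P i j)

/-- The product `a_{σ₁σ₂} ⋯ a_{σ_{k-1}σ_k}` along a word `σ`, which is `1` if `|σ| ≤ 1`. -/
def wordProd (a : Fin N → Fin N → ℝ) : List (Fin N) → ℝ
  | [] => 1
  | [_] => 1
  | i :: j :: l => a i j * wordProd a (j :: l)

/-- The set `G_∞` of infinite admissible sequences, with the product σ-algebra. -/
abbrev AdmSeq (P : Matrix (Fin N) (Fin N) ℝ) : Type :=
  {ω : ℕ → Fin N // ∀ h, 0 < P (ω h) (ω (h + 1))}

/-- The initial word `ω|_k` of length `k`. -/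
def AdmSeq.take {P : Matrix (Fin N) (Fin N) ℝ} (ω : AdmSeq P) (k : ℕ) : List (Fin N) :=
  (List.range k).map ω.1

/-- `m` is the Markov measure on `G_∞` with transition matrix `P` and initial vector `q`:
`m [i σ₂ … σ_k] = q_i p_{iσ₂} ⋯ p_{σ_{k-1}σ_k}` for every cylinder set. -/
def IsMarkovMeasure (P : Matrix (Fin N) (Fin N) ℝ) (q : Fin N → ℝ) (m : Measure (AdmSeq P)) :
    Prop :=
  ∀ (i : Fin N) (σ : List (Fin N)), Admissible P (i :: σ) →
    m {ω | ω.take (i :: σ).length = i :: σ} = ENNReal.ofReal (q i * wordProd P (i :: σ))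

/-- The number `s₀`. The terms with `P i j = 0` vanish, so the inner sums are over the `j` with
`P i j > 0`. -/
def sZero (P : Matrix (Fin N) (Fin N) ℝ) (c : Fin N → Fin N → ℝ) (v : Fin N → ℝ) : ℝ :=
  (∑ i, v i * ∑ j, P i j * Real.log (P i j)) / (∑ i, v i * ∑ j, P i j * Real.log (c i j))

/-- The data of the construction of a Mauldin–Williams fractal in `E`: cylinders `J_σ` for the
nonempty admissible words `σ` (the values of `cyl` at other words are irrelevant). -/
structure MWFractal (P : Matrix (Fin N) (Fin N) ℝ) (E : Type*) [NormedAddCommGroup E] where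
  /-- the contraction ratios `c_{ij}` -/
  ratio : Fin N → Fin N → ℝ
  ratio_mem : ∀ i j, 0 < P i j → 0 < ratio i j ∧ ratio i j < 1
  /-- the cylinders `J_σ` -/
  cyl : List (Fin N) → Set E
  nonempty_one : ∀ i, (cyl [i]).Nonempty
  isCompact_one : ∀ i, IsCompact (cyl [i])
  regular_one : ∀ i, closure (interior (cyl [i])) = cyl [i]
  subset : ∀ σ j, σ ≠ [] → Admissible P (σ ++ [j]) → cyl (σ ++ [j]) ⊆ cyl σ
  nonoverlapping : ∀ σ i j, σ ≠ [] → i ≠ j → Admissible P (σ ++ [i]) → Admissible P (σ ++ [j]) →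
    Disjoint (interior (cyl (σ ++ [i]))) (interior (cyl (σ ++ [j])))
  /-- `J_{σj}` is the image of `J_j` under a similarity of ratio `c_{σj}`. -/
  similar : ∀ σ j, σ ≠ [] → Admissible P (σ ++ [j]) →
    ∃ f : E → E, (∀ x y, dist (f x) (f y) = wordProd ratio (σ ++ [j]) * dist x y) ∧
      cyl (σ ++ [j]) = f '' cyl [j]

end Words

namespace MWFractal

variable {N : ℕ} {P : Matrix (Fin N) (Fin N) ℝ} {E : Type*} [NormedAddCommGroup E]

/-- The separation condition: there is `t ∈ (0,1)` such that
`d(J_{σi}, J_{σj}) ≥ t max {|J_{σi}|, |J_{σj}|}` whenever `i ≠ j` and `σi`, `σj` are admissible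
(the word `σ` may be empty). -/
def Separated (F : MWFractal P E) : Prop :=
  ∃ t : ℝ, 0 < t ∧ t < 1 ∧ ∀ (σ : List (Fin N)) (i j : Fin N), i ≠ j →
    Admissible P (σ ++ [i]) → Admissible P (σ ++ [j]) →
    ∀ x ∈ F.cyl (σ ++ [i]), ∀ y ∈ F.cyl (σ ++ [j]),
      t * max (Metric.diam (F.cyl (σ ++ [i]))) (Metric.diam (F.cyl (σ ++ [j]))) ≤ dist x y

theorem take_succ (ω : AdmSeq P) (k : ℕ) : ω.take (k + 1) = ω.take k ++ [ω.1 k] := by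
  simp [AdmSeq.take, List.range_succ]

theorem take_admissible (ω : AdmSeq P) (k : ℕ) : Admissible P (ω.take k) := by
  unfold Admissible AdmSeq.take
  rw [List.isChain_map]
  cases k with
  | zero => simp
  | succ k =>
    rw [List.isChain_range_succ]
    intro m _
    exact ω.2 m

theorem cyl_nonempty_isCompact (F : MWFractal P E) (ω : AdmSeq P) (k : ℕ) :
    (F.cyl (ω.take (k + 1))).Nonempty ∧ IsCompact (F.cyl (ω.take (k + 1))) := by
  cases k with
  | zero =>
    have h : ω.take (0 + 1) = [ω.1 0] := by simp [AdmSeq.take]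
    rw [h]
    exact ⟨F.nonempty_one _, F.isCompact_one _⟩
  | succ k =>
    have hne : ω.take (k + 1) ≠ [] := by simp [AdmSeq.take]
    have ha := take_admissible ω (k + 1 + 1)
    rw [take_succ ω (k + 1)] at ha ⊢
    obtain ⟨f, hf, he⟩ := F.similar _ _ hne ha
    rw [he]
    refine ⟨(F.nonempty_one _).image f, (F.isCompact_one _).image ?_⟩
    refine (LipschitzWith.of_dist_le_mul (K := Real.toNNReal
      (wordProd F.ratio (ω.take (k + 1) ++ [ω.1 (k + 1)]))) fun x y => ?_).continuous
    rw [hf x y]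
    exact mul_le_mul_of_nonneg_right (Real.le_coe_toNNReal _) dist_nonneg

theorem iInter_cyl_nonempty (F : MWFractal P E) (ω : AdmSeq P) :
    (⋂ k : ℕ, F.cyl (ω.take (k + 1))).Nonempty := by
  refine IsCompact.nonempty_iInter_of_sequence_nonempty_isCompact_isClosed _ ?_
    (fun k => (F.cyl_nonempty_isCompact ω k).1) (F.cyl_nonempty_isCompact ω 0).2
    (fun k => (F.cyl_nonempty_isCompact ω k).2.isClosed)
  intro k
  have hne : ω.take (k + 1) ≠ [] := by simp [AdmSeq.take]
  have ha := take_admissible ω (k + 1 + 1)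
  rw [take_succ ω (k + 1)] at ha ⊢
  exact F.subset _ _ hne ha

/-- The coding map `g : G_∞ → E`, where `g(ω)` is the point of `⋂_{k ≥ 1} J_{ω|_k}` (a single
point, since the diameters of the cylinders tend to zero). -/
def coding (F : MWFractal P E) (ω : AdmSeq P) : E :=
  (F.iInter_cyl_nonempty ω).some

/-- The Markov-type measure `μ = m ∘ g⁻¹` on the fractal set. -/
def markovTypeMeasure [MeasurableSpace E] (F : MWFractal P E) (m : Measure (AdmSeq P)) :
    Measure E :=
  m.map F.coding

end MWFractal

end GeoQuant

end

/-!
The theorem says that `log e_n(μ) = -s₀⁻¹ log n + O(1)` (`MWFractal.exists_geomError_bounds`);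
the dimensions and coefficients are read off from this.

Fix `ε` and follow a path `ω` until the probability `p_{ω₀ω₁} ⋯ p_{ω_{k-1}ω_k}` first drops to `ε`
or below (`stopTime`). The cylinders obtained in this way form a partition of the sequence space
into pieces of comparable mass `≈ ε`, and each has diameter comparable to the product `c_τ` of the
contraction ratios up to the stopping time. Three estimates give the result.

* `E log c_τ = s₀⁻¹ log ε + O(1)` (`exists_integral_log_pathProd_bound`). By the choice of `s₀`, the
  function `log p_{ij} - s₀ log c_{ij}` has mean zero for the stationary chain. Since `P` is
  irreducible, the Poisson equation (`exists_poisson_solution`) has a solution `u`, so that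
  `log p_{ij} - s₀ log c_{ij} + u_j - u_i` is the increment of a martingale. Optional stopping
  (`integral_sum_stopTime`) applies whatever the initial vector, and the term
  `u(ω_τ) - u(ω_0)` is bounded.
* Upper bound (`MWFractal.exists_meanLog_le`): with one point in each stopped cylinder, `O(1/ε)`
  points in all, the mean logarithmic distance is at most `E log c_τ + O(1)`.
* Lower bound (`MWFractal.exists_le_meanLog`): by the separation condition, the points of the
  fractal that are within distance of order `θ^k c_τ` of a given point `a` lie in one cylinder
  `k` levels below a stopped one, of mass at most `λ^k ε`, where `λ < 1` bounds the transition
  probabilities. Summing over `k` and over the at most `1/ε` points of `α` shows that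
  `∫ log d(x, α) dμ ≥ E log c_τ - O(1)`.
-/

namespace GeoQuant

/-! ### The Poisson equation of an irreducible stochastic matrix -/

section Poisson

variable {n : Type*} [Fintype n] [DecidableEq n]

theorem pow_mulVec_of_mulVec_eq {P : Matrix n n ℝ} {u : n → ℝ} (hu : P.mulVec u = u) (k : ℕ) :
    (P ^ k).mulVec u = u := by
  induction k with
  | zero => simp
  | succ k ih => rw [pow_succ, ← Matrix.mulVec_mulVec, hu, ih]

/-- The maximum principle: harmonic vectors of an irreducible stochastic matrix are constant. -/
theorem eq_of_mulVec_eq {P : Matrix n n ℝ} (hP : P ∈ Matrix.rowStochastic ℝ n)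
    (hirr : P.IsIrreducible) {u : n → ℝ} (hu : P.mulVec u = u) (i j : n) : u i = u j := by
  have : Nonempty n := ⟨i⟩
  obtain ⟨i₀, hi₀⟩ := Finite.exists_max u
  have key : ∀ j, u j = u i₀ := by
    intro j
    obtain ⟨k, -, hk⟩ := (Matrix.isIrreducible_iff_exists_pow_pos hirr.nonneg).1 hirr i₀ j
    have hPk := pow_mem hP k
    have h1 : ∑ l, (P ^ k) i₀ l * (u i₀ - u l) = 0 := by
      have h2 := congrFun (pow_mulVec_of_mulVec_eq hu k) i₀
      simp only [Matrix.mulVec, dotProduct] at h2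
      simp only [mul_sub, Finset.sum_sub_distrib, h2, ← Finset.sum_mul,
        Matrix.sum_row_of_mem_rowStochastic hPk]
      ring
    have h3 := (Finset.sum_eq_zero_iff_of_nonneg fun l _ =>
      mul_nonneg (Matrix.nonneg_of_mem_rowStochastic hPk) (sub_nonneg.2 (hi₀ l))).1 h1 j
      (Finset.mem_univ j)
    have h4 := (mul_eq_zero.1 h3).resolve_left hk.ne'
    linarith
  rw [key i, key j]

/-- The Poisson equation is solvable for every `f` of stationary mean zero: the kernel of `1 - P`
consists of the constants, so its range has codimension one and is the annihilator of `v`. -/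
theorem exists_poisson_solution {P : Matrix n n ℝ} (hP : P ∈ Matrix.rowStochastic ℝ n)
    (hirr : P.IsIrreducible) {v : n → ℝ} (hv_sum : ∑ i, v i = 1) (hv_eig : Matrix.vecMul v P = v)
    {f : n → ℝ} (hf : ∑ i, v i * f i = 0) :
    ∃ u : n → ℝ, ∀ i, f i + ∑ j, P i j * (u j - u i) = 0 := by
  set L : (n → ℝ) →ₗ[ℝ] (n → ℝ) := (1 - P).mulVecLin with hL
  let φ : Module.Dual ℝ (n → ℝ) := dotProductBilin ℝ ℝ v
  have hφ : ∀ x, φ x = ∑ i, v i * x i := fun x => rfl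
  have hφ0 : φ ≠ 0 := by
    intro h
    have h1 := hφ 1
    rw [h] at h1
    simp [hv_sum] at h1
  have hle : LinearMap.range L ≤ LinearMap.ker φ := by
    rintro _ ⟨x, rfl⟩
    rw [LinearMap.mem_ker]
    change dotProduct v ((1 - P).mulVec x) = 0
    rw [Matrix.dotProduct_mulVec, Matrix.vecMul_sub, hv_eig, Matrix.vecMul_one, sub_self,
      zero_dotProduct]
  have hker : Module.finrank ℝ (LinearMap.ker L) ≤ 1 := by
    refine (Submodule.finrank_mono (t := Submodule.span ℝ {(1 : n → ℝ)}) fun x hx => ?_).trans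
      ((finrank_span_le_card _).trans (by simp))
    have hx' : P.mulVec x = x := by
      have : (1 - P).mulVec x = 0 := hx
      rw [Matrix.sub_mulVec, Matrix.one_mulVec, sub_eq_zero] at this
      exact this.symm
    obtain ⟨i⟩ : Nonempty n := by
      by_contra h
      rw [not_nonempty_iff] at h
      simp at hv_sum
    refine Submodule.mem_span_singleton.2 ⟨x i, ?_⟩
    ext j
    simp [eq_of_mulVec_eq hP hirr hx' i j]
  have heq : LinearMap.range L = LinearMap.ker φ := by
    refine Submodule.eq_of_le_of_finrank_le hle ?_
    have h1 := L.finrank_range_add_finrank_ker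
    have h2 := Module.Dual.finrank_ker_add_one_of_ne_zero hφ0
    omega
  obtain ⟨u, hu⟩ : f ∈ LinearMap.range L := by
    rw [heq, LinearMap.mem_ker, hφ, hf]
  refine ⟨u, fun i => ?_⟩
  have h1 : u i - ∑ j, P i j * u j = f i := by
    rw [← hu, hL, Matrix.mulVecLin_apply, Matrix.sub_mulVec, Matrix.one_mulVec]
    rfl
  simp only [mul_sub, Finset.sum_sub_distrib, ← Finset.sum_mul,
    Matrix.sum_row_of_mem_rowStochastic hP]
  linarith

end Poisson

/-! ### Products along infinite paths -/

section Paths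

variable {N : ℕ} {P : Matrix (Fin N) (Fin N) ℝ}

/-- The product `a_{ω₀ω₁} ⋯ a_{ω_{k-1}ω_k}` of the first `k` transitions of `ω`. -/
noncomputable def pathProd (a : Fin N → Fin N → ℝ) (k : ℕ) (ω : AdmSeq P) : ℝ :=
  ∏ h ∈ Finset.range k, a (ω.1 h) (ω.1 (h + 1))

theorem wordProd_concat (a : Fin N → Fin N → ℝ) (σ : List (Fin N)) (i j : Fin N) :
    wordProd a (σ ++ [i, j]) = wordProd a (σ ++ [i]) * a i j := by
  induction σ with
  | nil => simp [wordProd]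
  | cons x l ih => cases l <;> simp_all [wordProd, mul_assoc]

theorem wordProd_take (a : Fin N → Fin N → ℝ) (k : ℕ) (ω : AdmSeq P) :
    wordProd a (ω.take (k + 1)) = pathProd a k ω := by
  induction k with
  | zero => simp [AdmSeq.take, wordProd, pathProd]
  | succ k ih =>
    rw [MWFractal.take_succ, MWFractal.take_succ, List.append_assoc, List.singleton_append,
      wordProd_concat, ← MWFractal.take_succ, ih, pathProd, pathProd, Finset.prod_range_succ]

theorem take_eq_take_iff {ω ω' : AdmSeq P} {k : ℕ} :
    ω.take k = ω'.take k ↔ ∀ h < k, ω.1 h = ω'.1 h := by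
  simp [AdmSeq.take]

theorem take_eq_take_of_le {ω ω' : AdmSeq P} {k l : ℕ} (h : ω.take k = ω'.take k) (hl : l ≤ k) :
    ω.take l = ω'.take l :=
  take_eq_take_iff.2 fun i hi => take_eq_take_iff.1 h i (hi.trans_le hl)

theorem length_take (ω : AdmSeq P) (k : ℕ) : (ω.take k).length = k := by
  simp [AdmSeq.take]

theorem pathProd_congr (a : Fin N → Fin N → ℝ) {ω ω' : AdmSeq P} {k : ℕ}
    (h : ω.take (k + 1) = ω'.take (k + 1)) : pathProd a k ω = pathProd a k ω' := by
  rw [← wordProd_take, ← wordProd_take, h]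

theorem pathProd_pos {a : Fin N → Fin N → ℝ} (ha : ∀ i j, 0 < P i j → 0 < a i j) (k : ℕ)
    (ω : AdmSeq P) : 0 < pathProd a k ω :=
  Finset.prod_pos fun h _ => ha _ _ (ω.2 h)

theorem pathProd_add_le {a : Fin N → Fin N → ℝ} {r : ℝ}
    (ha : ∀ i j, 0 < P i j → 0 < a i j ∧ a i j ≤ r) (k l : ℕ) (ω : AdmSeq P) :
    pathProd a (k + l) ω ≤ r ^ l * pathProd a k ω := by
  induction l with
  | zero => simp
  | succ l ih =>
    have h0 := ha _ _ (ω.2 (k + l))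
    have h1 : pathProd a (k + (l + 1)) ω =
        pathProd a (k + l) ω * a (ω.1 (k + l)) (ω.1 (k + l + 1)) :=
      Finset.prod_range_succ _ _
    rw [h1, pow_succ]
    calc pathProd a (k + l) ω * a (ω.1 (k + l)) (ω.1 (k + l + 1))
        ≤ (r ^ l * pathProd a k ω) * r := by
          refine mul_le_mul ih h0.2 h0.1.le ?_
          exact mul_nonneg (pow_nonneg (h0.1.le.trans h0.2) _)
            (pathProd_pos (fun i j h => (ha i j h).1) k ω).le
      _ = _ := by ring

theorem le_pathProd_add {a : Fin N → Fin N → ℝ} {r : ℝ} (hr : 0 ≤ r)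
    (ha : ∀ i j, 0 < P i j → 0 < a i j ∧ r ≤ a i j) (k l : ℕ) (ω : AdmSeq P) :
    r ^ l * pathProd a k ω ≤ pathProd a (k + l) ω := by
  induction l with
  | zero => simp
  | succ l ih =>
    have h0 := ha _ _ (ω.2 (k + l))
    have h1 : pathProd a (k + (l + 1)) ω =
        pathProd a (k + l) ω * a (ω.1 (k + l)) (ω.1 (k + l + 1)) :=
      Finset.prod_range_succ _ _
    rw [h1, pow_succ]
    calc r ^ l * r * pathProd a k ω = (r ^ l * pathProd a k ω) * r := by ring
      _ ≤ pathProd a (k + l) ω * a (ω.1 (k + l)) (ω.1 (k + l + 1)) :=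
          mul_le_mul ih h0.2 hr (pathProd_pos (fun i j h => (ha i j h).1) _ ω).le

theorem pathProd_anti {a : Fin N → Fin N → ℝ} (ha : ∀ i j, 0 < P i j → 0 < a i j ∧ a i j ≤ 1)
    {k l : ℕ} (h : k ≤ l) (ω : AdmSeq P) : pathProd a l ω ≤ pathProd a k ω := by
  obtain ⟨d, rfl⟩ := Nat.exists_eq_add_of_le h
  simpa using pathProd_add_le ha k d ω

theorem log_pathProd {a : Fin N → Fin N → ℝ} (ha : ∀ i j, 0 < P i j → 0 < a i j) (k : ℕ)
    (ω : AdmSeq P) :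
    Real.log (pathProd a k ω) = ∑ h ∈ Finset.range k, Real.log (a (ω.1 h) (ω.1 (h + 1))) :=
  Real.log_prod fun h _ => (ha _ _ (ω.2 h)).ne'

end Paths

/-! ### Markov measures -/

section Markov

variable {N : ℕ} {P : Matrix (Fin N) (Fin N) ℝ} {q : Fin N → ℝ} {m : Measure (AdmSeq P)}

theorem measurable_coord (h : ℕ) : Measurable fun ω : AdmSeq P => ω.1 h :=
  (measurable_pi_apply h).comp measurable_subtype_coe

theorem measurableSet_take_eq (k : ℕ) (σ : List (Fin N)) :
    MeasurableSet {ω : AdmSeq P | ω.take k = σ} := by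
  by_cases h : ∃ η : AdmSeq P, η.take k = σ
  · obtain ⟨η, rfl⟩ := h
    simp only [take_eq_take_iff, Set.ofPred_forall]
    exact MeasurableSet.iInter fun i => MeasurableSet.iInter fun _ =>
      measurable_coord i (measurableSet_singleton _)
  · convert MeasurableSet.empty
    ext ω
    simpa using fun hω => h ⟨ω, hω⟩

theorem measure_take_eq_take (hm : IsMarkovMeasure P q m) (k : ℕ) (ω : AdmSeq P) :
    m {η | η.take (k + 1) = ω.take (k + 1)} =
      ENNReal.ofReal (q (ω.1 0) * pathProd P k ω) := by
  have h0 : ω.take (k + 1) = ω.1 0 :: (ω.take (k + 1)).tail := by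
    simp [AdmSeq.take, List.range_succ_eq_map]
  have h1 := hm (ω.1 0) (ω.take (k + 1)).tail (h0 ▸ MWFractal.take_admissible ω (k + 1))
  rw [← h0, length_take, wordProd_take P k ω] at h1
  exact h1

theorem measure_take_eq_take_le (hm : IsMarkovMeasure P q m) (hq1 : ∀ i, q i ≤ 1) (k : ℕ)
    (ω : AdmSeq P) :
    m {η | η.take (k + 1) = ω.take (k + 1)} ≤ ENNReal.ofReal (pathProd P k ω) := by
  rw [measure_take_eq_take hm]
  refine ENNReal.ofReal_le_ofReal ?_
  exact mul_le_of_le_one_left (pathProd_pos (fun _ _ h => h) k ω).le (hq1 _)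

theorem isProbabilityMeasure_of_isMarkovMeasure (hm : IsMarkovMeasure P q m) (hq : ∀ i, 0 < q i)
    (hq_sum : ∑ i, q i = 1) : IsProbabilityMeasure m := by
  constructor
  have h1 : (Set.univ : Set (AdmSeq P)) = ⋃ i, {ω | ω.take 1 = [i]} := by
    ext ω
    simp [AdmSeq.take]
  rw [h1, measure_iUnion _ fun i => measurableSet_take_eq _ _, tsum_fintype]
  · have h2 : ∀ i, m {ω | ω.take 1 = [i]} = ENNReal.ofReal (q i) := fun i => by
      simpa [wordProd] using hm i [] (by simp [Admissible])
    simp only [h2]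
    rw [← ENNReal.ofReal_sum_of_nonneg fun i _ => (hq i).le, hq_sum, ENNReal.ofReal_one]
  · intro i j hij
    refine Set.disjoint_left.2 fun ω h h' => hij ?_
    simp only [Set.mem_ofPred_eq] at h h'
    simpa using h.symm.trans h'

/-- The Markov property on the level of cylinders; it also holds for words that are not
admissible, whose cylinders are empty. -/
theorem measureReal_take_concat (hP : ∀ i j, 0 ≤ P i j) (hq : ∀ i, 0 < q i)
    (hm : IsMarkovMeasure P q m) (σ : List (Fin N)) (i j : Fin N) :
    m.real {ω | ω.take (σ.length + 2) = σ ++ [i, j]} =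
      m.real {ω | ω.take (σ.length + 1) = σ ++ [i]} * P i j := by
  by_cases had : Admissible P (σ ++ [i])
  · rcases (hP i j).eq_or_lt with h0 | hpos
    · rw [← h0, mul_zero]
      convert measureReal_empty (μ := m)
      ext ω
      simp only [Set.mem_ofPred_eq, Set.mem_empty_iff_false, iff_false]
      intro h
      have h1 := MWFractal.take_admissible ω (σ.length + 2)
      rw [h, Admissible, List.isChain_append] at h1
      have h2 : 0 < P i j := by simpa using h1.2.1
      exact h2.ne h0
    · have had2 : Admissible P (σ ++ [i, j]) := by
        rw [Admissible, List.isChain_append] at had ⊢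
        exact ⟨had.1, by simpa using hpos, by simpa using had.2.2⟩
      have hw : 0 ≤ wordProd P (σ ++ [i]) := by
        generalize σ ++ [i] = τ
        induction τ with
        | nil => simp [wordProd]
        | cons x l ih =>
          cases l with
          | nil => simp [wordProd]
          | cons y l => exact mul_nonneg (hP _ _) ih
      cases σ with
      | nil =>
        have h1 := hm i [] had
        have h2 := hm i [j] had2
        simp only [List.length_cons, List.length_nil, zero_add, List.nil_append, Nat.reduceAdd,
          measureReal_def] at h1 h2 ⊢
        rw [h1, h2]
        simp [wordProd, (hq i).le, hP]
      | cons x l =>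
        have h1 := hm x (l ++ [i]) had
        have h2 := hm x (l ++ [i, j]) had2
        have h3 := wordProd_concat P (x :: l) i j
        simp only [List.cons_append, List.length_cons, List.length_append, List.length_nil,
          zero_add, Nat.reduceAdd, measureReal_def] at h1 h2 h3 hw ⊢
        rw [show l.length + 1 + 2 = l.length + 2 + 1 from rfl, h1, h2, h3,
          ENNReal.toReal_ofReal (mul_nonneg (hq x).le hw),
          ENNReal.toReal_ofReal (mul_nonneg (hq x).le (mul_nonneg hw (hP _ _))), mul_assoc]
  · have h1 : {ω : AdmSeq P | ω.take (σ.length + 1) = σ ++ [i]} = ∅ := by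
      ext ω
      simp only [Set.mem_ofPred_eq, Set.mem_empty_iff_false, iff_false]
      intro h
      exact had (h ▸ MWFractal.take_admissible ω _)
    have h2 : {ω : AdmSeq P | ω.take (σ.length + 2) = σ ++ [i, j]} = ∅ := by
      ext ω
      simp only [Set.mem_ofPred_eq, Set.mem_empty_iff_false, iff_false]
      intro h
      rw [MWFractal.take_succ, ← List.singleton_append (l := [j]), ← List.append_assoc] at h
      have h3 := (List.append_inj' h rfl).1
      exact had (h3 ▸ MWFractal.take_admissible ω _)
    simp [h1, h2]

theorem take_eq_ofFn (k : ℕ) (ω : AdmSeq P) : ω.take k = List.ofFn fun i : Fin k => ω.1 i := by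
  refine List.ext_getElem (by simp [length_take]) fun i h1 h2 => ?_
  simp [AdmSeq.take]

theorem integrable_of_take [IsFiniteMeasure m] (k : ℕ) (φ : List (Fin N) → ℝ) :
    Integrable (fun ω : AdmSeq P => φ (ω.take k)) m := by
  have hX : Measurable fun ω : AdmSeq P => fun i : Fin k => ω.1 i :=
    measurable_pi_lambda _ fun i => measurable_coord _
  have h := (integrable_map_measure (μ := m) (g := fun w : Fin k → Fin N => φ (List.ofFn w))
    (measurable_of_finite _).aestronglyMeasurable hX.aemeasurable).1 Integrable.of_finite
  refine h.congr (Eventually.of_forall fun ω => ?_)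
  simp [take_eq_ofFn]

/-- Increments with conditional mean zero are orthogonal to functions of the past. -/
theorem integral_past_mul_increment (hP : ∀ i j, 0 ≤ P i j) (hq : ∀ i, 0 < q i)
    (hm : IsMarkovMeasure P q m) [IsFiniteMeasure m] (k : ℕ) (φ : List (Fin N) → ℝ)
    {ψ : Fin N → Fin N → ℝ} (hψ : ∀ i, ∑ j, P i j * ψ i j = 0) :
    ∫ ω : AdmSeq P, φ (ω.take (k + 1)) * ψ (ω.1 k) (ω.1 (k + 1)) ∂m = 0 := by
  let X : AdmSeq P → (Fin k → Fin N) × Fin N × Fin N :=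
    fun ω => (fun i : Fin k => ω.1 i, ω.1 k, ω.1 (k + 1))
  have hX : Measurable X := (measurable_pi_lambda _ fun i => measurable_coord _).prodMk
    ((measurable_coord _).prodMk (measurable_coord _))
  let G : (Fin k → Fin N) × Fin N × Fin N → ℝ :=
    fun w => φ (List.ofFn w.1 ++ [w.2.1]) * ψ w.2.1 w.2.2
  have h1 : ∀ ω : AdmSeq P, φ (ω.take (k + 1)) * ψ (ω.1 k) (ω.1 (k + 1)) = G (X ω) := fun ω => by
    simp only [G, X]
    rw [MWFractal.take_succ, take_eq_ofFn]
  simp only [h1]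
  rw [← integral_map (f := G) hX.aemeasurable (measurable_of_finite _).aestronglyMeasurable,
    integral_fintype Integrable.of_finite, Fintype.sum_prod_type]
  refine Finset.sum_eq_zero fun w _ => ?_
  rw [Fintype.sum_prod_type]
  refine Finset.sum_eq_zero fun i _ => ?_
  have h2 : ∀ j, (m.map X).real {(w, i, j)} =
      m.real {ω | ω.take (k + 1) = List.ofFn w ++ [i]} * P i j := by
    intro j
    have h3 := measureReal_take_concat hP hq hm (List.ofFn w) i j
    rw [List.length_ofFn] at h3
    rw [← h3, map_measureReal_apply hX (measurableSet_singleton _)]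
    congr 1
    ext ω
    simp only [X, Set.mem_preimage, Set.mem_singleton_iff, Prod.mk.injEq, Set.mem_ofPred_eq]
    rw [MWFractal.take_succ, MWFractal.take_succ, take_eq_ofFn, List.append_assoc,
      List.singleton_append]
    constructor
    · rintro ⟨rfl, rfl, rfl⟩
      rfl
    · intro h
      obtain ⟨h4, h5⟩ := List.append_inj' h rfl
      simp only [List.cons.injEq, and_true] at h5
      exact ⟨List.ofFn_injective h4, h5⟩
  simp only [h2, G, smul_eq_mul]
  have h4 := congrArg
    (m.real {ω | ω.take (k + 1) = List.ofFn w ++ [i]} * φ (List.ofFn w ++ [i]) * ·) (hψ i)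
  simp only [Finset.mul_sum, mul_zero] at h4
  exact Eq.trans (Finset.sum_congr rfl fun j _ => by ring) h4

end Markov

/-! ### Stopping when the transition probability gets small -/

section Stopping

variable {N : ℕ} {P : Matrix (Fin N) (Fin N) ℝ} {q : Fin N → ℝ} {m : Measure (AdmSeq P)}
  {ε lam : ℝ}

/-- The first time `k` at which `p_{ω₀ω₁} ⋯ p_{ω_{k-1}ω_k} ≤ ε`. -/
noncomputable def stopTime (ε : ℝ) (ω : AdmSeq P) : ℕ :=
  sInf {k | pathProd P k ω ≤ ε}

theorem pathProd_le_of_pow_le (hlam : ∀ i j, P i j ≤ lam) {K : ℕ} (hK : lam ^ K ≤ ε)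
    (ω : AdmSeq P) : pathProd P K ω ≤ ε := by
  have h := pathProd_add_le (a := P) (r := lam) (fun i j h => ⟨h, hlam i j⟩) 0 K ω
  simp only [zero_add, pathProd, Finset.range_zero, Finset.prod_empty, mul_one] at h
  exact h.trans hK

theorem stopTime_le {k : ℕ} {ω : AdmSeq P} (h : pathProd P k ω ≤ ε) : stopTime ε ω ≤ k :=
  Nat.sInf_le h

theorem pathProd_stopTime_le (hlam : ∀ i j, P i j ≤ lam) (hlam1 : lam < 1) (hε : 0 < ε)
    (ω : AdmSeq P) : pathProd P (stopTime ε ω) ω ≤ ε := by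
  obtain ⟨K, hK⟩ := exists_pow_lt_of_lt_one hε hlam1
  have : {k | pathProd P k ω ≤ ε}.Nonempty := ⟨K, pathProd_le_of_pow_le hlam hK.le ω⟩
  exact Nat.sInf_mem this

theorem lt_pathProd_of_lt_stopTime {ω : AdmSeq P} {k : ℕ} (h : k < stopTime ε ω) :
    ε < pathProd P k ω :=
  not_le.1 (Nat.notMem_of_lt_sInf h)

theorem mul_le_pathProd_stopTime {p : ℝ} (hp : ∀ i j, 0 < P i j → p ≤ P i j) (hp0 : 0 ≤ p)
    (hp1 : p ≤ 1) (hε1 : ε ≤ 1) (ω : AdmSeq P) : p * ε ≤ pathProd P (stopTime ε ω) ω := by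
  rcases h : stopTime ε ω with _ | k
  · simp only [pathProd, Finset.range_zero, Finset.prod_empty]
    nlinarith
  · have h1 := lt_pathProd_of_lt_stopTime (ω := ω) (ε := ε) (k := k) (by omega)
    have h2 := le_pathProd_add (a := P) hp0 (fun i j h => ⟨h, hp i j h⟩) k 1 ω
    rw [pow_one] at h2
    exact (mul_le_mul_of_nonneg_left h1.le hp0).trans h2

theorem stopTime_congr (hlam : ∀ i j, P i j ≤ lam) (hlam1 : lam < 1) (hε : 0 < ε) {ω η : AdmSeq P}
    (h : ω.take (stopTime ε ω + 1) = η.take (stopTime ε ω + 1)) :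
    stopTime ε η = stopTime ε ω := by
  refine le_antisymm ?_ ?_
  · refine stopTime_le ?_
    rw [← pathProd_congr P h]
    exact pathProd_stopTime_le hlam hlam1 hε ω
  · by_contra hlt
    push Not at hlt
    refine (lt_pathProd_of_lt_stopTime hlt).not_ge ?_
    rw [pathProd_congr P (take_eq_take_of_le h (Nat.succ_le_succ hlt.le))]
    exact pathProd_stopTime_le hlam hlam1 hε η

/-- A sum up to the stopping time as a sum of fixed length whose terms have factors determined by
the past. -/
theorem sum_range_stopTime (hlam : ∀ i j, P i j ≤ lam) (hlam1 : lam < 1) (hε : 0 < ε)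
    {K : ℕ} (hK : lam ^ K ≤ ε) (ψ : Fin N → Fin N → ℝ) (ω : AdmSeq P) :
    ∑ h ∈ Finset.range (stopTime ε ω), ψ (ω.1 h) (ω.1 (h + 1)) =
      ∑ h ∈ Finset.range K,
        (if ε < wordProd P (ω.take (h + 1)) then 1 else 0) * ψ (ω.1 h) (ω.1 (h + 1)) := by
  have hle : stopTime ε ω ≤ K := stopTime_le (pathProd_le_of_pow_le hlam hK ω)
  rw [← Finset.sum_subset (Finset.range_subset_range.2 hle)]
  · refine Finset.sum_congr rfl fun h hh => ?_
    rw [wordProd_take P h ω, if_pos (lt_pathProd_of_lt_stopTime (Finset.mem_range.1 hh)), one_mul]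
  · intro h _ hh
    have h1 : stopTime ε ω ≤ h := by simpa using hh
    rw [wordProd_take P h ω, if_neg, zero_mul]
    rw [not_lt]
    refine (pathProd_anti (a := P) (fun i j h => ⟨h, (hlam i j).trans hlam1.le⟩) h1 ω).trans ?_
    exact pathProd_stopTime_le hlam hlam1 hε ω

theorem integrable_past_mul [IsFiniteMeasure m] (h : ℕ) (φ : List (Fin N) → ℝ)
    (ψ : Fin N → Fin N → ℝ) :
    Integrable (fun ω : AdmSeq P => φ (ω.take (h + 1)) * ψ (ω.1 h) (ω.1 (h + 1))) m := by
  -- The integrand is a function of the word of length `h + 2`.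
  refine (integrable_of_take (m := m) (h + 2) fun σ => φ (σ.take (h + 1)) *
    (if hσ : h + 1 < σ.length then ψ (σ[h]) (σ[h + 1]) else 0)).congr
    (Eventually.of_forall fun ω => ?_)
  have h1 : (ω.take (h + 2)).take (h + 1) = ω.take (h + 1) := by
    rw [MWFractal.take_succ ω (h + 1), List.take_left' (length_take ω _)]
  simp [h1, length_take]
  left
  simp [AdmSeq.take]

theorem integrable_sum_stopTime [IsFiniteMeasure m] (hlam : ∀ i j, P i j ≤ lam) (hlam1 : lam < 1)
    (hε : 0 < ε) (ψ : Fin N → Fin N → ℝ) :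
    Integrable (fun ω : AdmSeq P =>
      ∑ h ∈ Finset.range (stopTime ε ω), ψ (ω.1 h) (ω.1 (h + 1))) m := by
  obtain ⟨K, hK⟩ := exists_pow_lt_of_lt_one hε hlam1
  simp only [sum_range_stopTime hlam hlam1 hε hK.le]
  exact integrable_finsetSum _ fun h _ => integrable_past_mul h
    (fun σ => if ε < wordProd P σ then 1 else 0) ψ

/-- Optional stopping for the martingale with increments `ψ(ω_h, ω_{h+1})`. -/
theorem integral_sum_stopTime (hP : ∀ i j, 0 ≤ P i j) (hq : ∀ i, 0 < q i)
    (hm : IsMarkovMeasure P q m) [IsFiniteMeasure m] (hlam : ∀ i j, P i j ≤ lam)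
    (hlam1 : lam < 1) (hε : 0 < ε) {ψ : Fin N → Fin N → ℝ}
    (hψ : ∀ i, ∑ j, P i j * ψ i j = 0) :
    ∫ ω : AdmSeq P, ∑ h ∈ Finset.range (stopTime ε ω), ψ (ω.1 h) (ω.1 (h + 1)) ∂m = 0 := by
  obtain ⟨K, hK⟩ := exists_pow_lt_of_lt_one hε hlam1
  simp only [sum_range_stopTime hlam hlam1 hε hK.le]
  rw [integral_finsetSum _ fun h _ => integrable_past_mul h
    (fun σ => if ε < wordProd P σ then 1 else 0) ψ]
  exact Finset.sum_eq_zero fun h _ => integral_past_mul_increment hP hq hm h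
    (fun σ => if ε < wordProd P σ then 1 else 0) hψ

end Stopping

/-! ### The mean of the contraction ratios at the stopping time -/

section MeanRatio

variable {N : ℕ} {P : Matrix (Fin N) (Fin N) ℝ}

theorem exists_pos_le {ι : Type*} [Finite ι] {f : ι → ℝ} (hf : ∀ i, 0 < f i) :
    ∃ r, 0 < r ∧ r ≤ 1 ∧ ∀ i, r ≤ f i := by
  rcases isEmpty_or_nonempty ι with h | h
  · exact ⟨1, one_pos, le_rfl, fun i => h.elim i⟩
  · obtain ⟨i₀, hi₀⟩ := Finite.exists_min f
    exact ⟨min 1 (f i₀), lt_min one_pos (hf i₀), min_le_left _ _,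
      fun i => (min_le_right _ _).trans (hi₀ i)⟩

theorem exists_pos_le_of_transition {a : Fin N → Fin N → ℝ} (ha : ∀ i j, 0 < P i j → 0 < a i j) :
    ∃ r, 0 < r ∧ r ≤ 1 ∧ ∀ i j, 0 < P i j → r ≤ a i j := by
  obtain ⟨r, hr, hr1, h⟩ := exists_pos_le
    (f := fun x : {x : Fin N × Fin N // 0 < P x.1 x.2} => a x.1.1 x.1.2) fun x => ha _ _ x.2
  exact ⟨r, hr, hr1, fun i j hij => h ⟨(i, j), hij⟩⟩

theorem exists_le_lt_one_of_transition {a : Fin N → Fin N → ℝ}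
    (ha : ∀ i j, 0 < P i j → a i j < 1) :
    ∃ r, 0 ≤ r ∧ r < 1 ∧ ∀ i j, 0 < P i j → a i j ≤ r := by
  obtain ⟨r, hr, hr1, h⟩ := exists_pos_le_of_transition (P := P) (a := fun i j => 1 - a i j)
    fun i j hij => sub_pos.2 (ha i j hij)
  exact ⟨1 - r, by linarith, by linarith, fun i j hij => by linarith [h i j hij]⟩

/-- Each row has two positive entries, so no transition is deterministic. -/
theorem lt_one_of_two_le_ncard (hP : P ∈ Matrix.rowStochastic ℝ (Fin N))
    (hcard : ∀ i, 2 ≤ {j | 0 < P i j}.ncard) (i j : Fin N) : P i j < 1 := by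
  obtain ⟨l, hl, hlj⟩ := Set.exists_ne_of_one_lt_ncard (hcard i) j
  have h1 := Matrix.sum_row_of_mem_rowStochastic hP i
  have h2 : P i j + P i l ≤ ∑ x, P i x := by
    rw [← Finset.sum_pair hlj.symm]
    exact Finset.sum_le_sum_of_subset_of_nonneg (Finset.subset_univ _)
      fun x _ _ => Matrix.nonneg_of_mem_rowStochastic hP
  have h3 : 0 < P i l := hl
  linarith

theorem exists_transition_le (hP : P ∈ Matrix.rowStochastic ℝ (Fin N))
    (hcard : ∀ i, 2 ≤ {j | 0 < P i j}.ncard) :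
    ∃ lam, 0 ≤ lam ∧ lam < 1 ∧ ∀ i j, P i j ≤ lam := by
  obtain ⟨lam, hlam0, hlam1, hlam⟩ := exists_le_lt_one_of_transition (P := P) (a := P)
    fun i j _ => lt_one_of_two_le_ncard hP hcard i j
  refine ⟨lam, hlam0, hlam1, fun i j => ?_⟩
  rcases (Matrix.nonneg_of_mem_rowStochastic hP : 0 ≤ P i j).eq_or_lt with h | h
  · exact h ▸ hlam0
  · exact hlam i j h

theorem sum_mul_log_neg (hP : P ∈ Matrix.rowStochastic ℝ (Fin N)) {v : Fin N → ℝ}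
    (hv_pos : ∀ i, 0 < v i) (hv_sum : ∑ i, v i = 1) {a : Fin N → Fin N → ℝ}
    (ha : ∀ i j, 0 < P i j → 0 < a i j ∧ a i j < 1) :
    ∑ i, v i * ∑ j, P i j * Real.log (a i j) < 0 := by
  have hne : (Finset.univ : Finset (Fin N)).Nonempty := by
    by_contra h
    rw [Finset.not_nonempty_iff_eq_empty] at h
    simp [h] at hv_sum
  refine Finset.sum_neg (fun i _ => mul_neg_of_pos_of_neg (hv_pos i) ?_) hne
  have hterm : ∀ j, 0 < P i j → P i j * Real.log (a i j) < 0 := fun j hj =>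
    mul_neg_of_pos_of_neg hj (Real.log_neg (ha i j hj).1 (ha i j hj).2)
  obtain ⟨j, hj⟩ : ∃ j, 0 < P i j := by
    by_contra! h
    have h1 := Matrix.sum_row_of_mem_rowStochastic hP i
    have h2 := Finset.sum_nonpos fun j (_ : j ∈ Finset.univ) => h j
    linarith
  refine Finset.sum_neg' (fun j _ => ?_) ⟨j, Finset.mem_univ _, hterm j hj⟩
  rcases (Matrix.nonneg_of_mem_rowStochastic hP : 0 ≤ P i j).eq_or_lt with h | h
  · rw [← h, zero_mul]
  · exact (hterm j h).le

theorem sZero_pos (hP : P ∈ Matrix.rowStochastic ℝ (Fin N))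
    (hcard : ∀ i, 2 ≤ {j | 0 < P i j}.ncard) {v : Fin N → ℝ} (hv_pos : ∀ i, 0 < v i)
    (hv_sum : ∑ i, v i = 1) {c : Fin N → Fin N → ℝ}
    (hc : ∀ i j, 0 < P i j → 0 < c i j ∧ c i j < 1) : 0 < sZero P c v :=
  div_pos_of_neg_of_neg
    (sum_mul_log_neg hP hv_pos hv_sum fun i j h => ⟨h, lt_one_of_two_le_ncard hP hcard i j⟩)
    (sum_mul_log_neg hP hv_pos hv_sum hc)

theorem integrable_log_pathProd_stopTime {m : Measure (AdmSeq P)} [IsFiniteMeasure m] {lam ε : ℝ}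
    (hlam : ∀ i j, P i j ≤ lam) (hlam1 : lam < 1) (hε : 0 < ε) {c : Fin N → Fin N → ℝ}
    (hc : ∀ i j, 0 < P i j → 0 < c i j) :
    Integrable (fun ω : AdmSeq P => Real.log (pathProd c (stopTime ε ω) ω)) m := by
  simp only [log_pathProd hc]
  exact integrable_sum_stopTime hlam hlam1 hε fun i j => Real.log (c i j)

/-- Stopping when the probability of the path falls below `ε`, the logarithm of the contraction
ratio has mean `s₀⁻¹ log ε + O(1)`. Indeed `log p - s₀ log c` has stationary mean zero, so it is
turned into the increment of a martingale by the coboundary of a solution `u` of the Poisson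
equation, and the coboundary contributes at most `2 max |u|`. -/
theorem exists_integral_log_pathProd_bound (hP : P ∈ Matrix.rowStochastic ℝ (Fin N))
    (hirr : P.IsIrreducible) (hcard : ∀ i, 2 ≤ {j | 0 < P i j}.ncard) {v : Fin N → ℝ}
    (hv_pos : ∀ i, 0 < v i) (hv_sum : ∑ i, v i = 1) (hv_eig : Matrix.vecMul v P = v)
    {c : Fin N → Fin N → ℝ} (hc : ∀ i j, 0 < P i j → 0 < c i j ∧ c i j < 1) :
    ∃ C : ℝ, ∀ (q : Fin N → ℝ) (m : Measure (AdmSeq P)), (∀ i, 0 < q i) → ∑ i, q i = 1 →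
      IsMarkovMeasure P q m → ∀ ε : ℝ, 0 < ε → ε ≤ 1 →
        |sZero P c v * ∫ ω, Real.log (pathProd c (stopTime ε ω) ω) ∂m - Real.log ε| ≤ C := by
  have hnn : ∀ i j, 0 ≤ P i j := fun i j => Matrix.nonneg_of_mem_rowStochastic hP
  obtain ⟨lam, -, hlam1, hlam⟩ := exists_transition_le hP hcard
  obtain ⟨p, hp0, hp1, hp⟩ := exists_pos_le_of_transition (P := P) (a := P) fun i j h => h
  set s := sZero P c v with hs
  have hden := sum_mul_log_neg hP hv_pos hv_sum hc
  obtain ⟨u, hu⟩ := exists_poisson_solution hP hirr hv_sum hv_eig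
    (f := fun i => ∑ j, P i j * (Real.log (P i j) - s * Real.log (c i j))) (by
      have h1 : s * ∑ i, v i * ∑ j, P i j * Real.log (c i j) =
          ∑ i, v i * ∑ j, P i j * Real.log (P i j) := div_mul_cancel₀ _ hden.ne
      rw [Finset.mul_sum] at h1
      rw [← sub_eq_zero.2 h1.symm, ← Finset.sum_sub_distrib]
      refine Finset.sum_congr rfl fun i _ => ?_
      have h2 : ∑ j, P i j * (Real.log (P i j) - s * Real.log (c i j)) =
          ∑ j, P i j * Real.log (P i j) - s * ∑ j, P i j * Real.log (c i j) := by
        rw [Finset.mul_sum, ← Finset.sum_sub_distrib]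
        exact Finset.sum_congr rfl fun j _ => by ring
      rw [h2]
      ring)
  let ψ : Fin N → Fin N → ℝ :=
    fun i j => (Real.log (P i j) - s * Real.log (c i j)) + (u j - u i)
  have hψ : ∀ i, ∑ j, P i j * ψ i j = 0 := fun i => by
    rw [← hu i, ← Finset.sum_add_distrib]
    exact Finset.sum_congr rfl fun j _ => mul_add _ _ _
  obtain ⟨B, hB⟩ : ∃ B, ∀ i, |u i| ≤ B := by
    refine ⟨∑ i, |u i|, fun i => ?_⟩
    exact Finset.single_le_sum (f := fun i => |u i|) (fun j _ => abs_nonneg _) (Finset.mem_univ i)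
  refine ⟨2 * B - Real.log p, fun q m hq hq_sum hm ε hε hε1 => ?_⟩
  have := isProbabilityMeasure_of_isMarkovMeasure hm hq hq_sum
  have hint := integrable_sum_stopTime (m := m) hlam hlam1 hε ψ
  have hzero := integral_sum_stopTime hnn hq hm hlam hlam1 hε hψ
  have hlogint := integrable_log_pathProd_stopTime (m := m) hlam hlam1 hε fun i j h => (hc i j h).1
  have hpt : ∀ ω : AdmSeq P, |s * Real.log (pathProd c (stopTime ε ω) ω) +
      ∑ h ∈ Finset.range (stopTime ε ω), ψ (ω.1 h) (ω.1 (h + 1)) - Real.log ε| ≤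
        2 * B - Real.log p := by
    intro ω
    have h1 : ∑ h ∈ Finset.range (stopTime ε ω), ψ (ω.1 h) (ω.1 (h + 1)) =
        Real.log (pathProd P (stopTime ε ω) ω) - s * Real.log (pathProd c (stopTime ε ω) ω) +
          (u (ω.1 (stopTime ε ω)) - u (ω.1 0)) := by
      rw [log_pathProd (fun i j h => (hc i j h).1), log_pathProd (a := P) (fun i j h => h),
        Finset.mul_sum, ← Finset.sum_sub_distrib, ← Finset.sum_range_sub (fun h => u (ω.1 h)),
        ← Finset.sum_add_distrib]
    have h2 : Real.log (pathProd P (stopTime ε ω) ω) ≤ Real.log ε :=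
      Real.log_le_log (pathProd_pos (fun _ _ h => h) _ _) (pathProd_stopTime_le hlam hlam1 hε ω)
    have h3 : Real.log p + Real.log ε ≤ Real.log (pathProd P (stopTime ε ω) ω) := by
      rw [← Real.log_mul hp0.ne' hε.ne']
      exact Real.log_le_log (mul_pos hp0 hε) (mul_le_pathProd_stopTime hp hp0.le hp1 hε1 ω)
    have h4 := abs_le.1 (hB (ω.1 (stopTime ε ω)))
    have h5 := abs_le.1 (hB (ω.1 0))
    have h6 : Real.log p ≤ 0 := Real.log_nonpos hp0.le hp1
    rw [h1, abs_le]
    constructor <;> linarith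
  have heq : s * ∫ ω, Real.log (pathProd c (stopTime ε ω) ω) ∂m - Real.log ε =
      ∫ ω, (s * Real.log (pathProd c (stopTime ε ω) ω) +
        ∑ h ∈ Finset.range (stopTime ε ω), ψ (ω.1 h) (ω.1 (h + 1)) - Real.log ε) ∂m := by
    have hsum : Integrable (fun ω : AdmSeq P => s * Real.log (pathProd c (stopTime ε ω) ω) +
        ∑ h ∈ Finset.range (stopTime ε ω), ψ (ω.1 h) (ω.1 (h + 1))) m :=
      (hlogint.const_mul s).add hint
    rw [integral_sub hsum (integrable_const _),
      integral_add (hlogint.const_mul s) hint, hzero, integral_const_mul]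
    simp
  rw [heq]
  have h7 := norm_integral_le_of_norm_le_const (μ := m)
    (Eventually.of_forall fun ω => (Real.norm_eq_abs _).trans_le (hpt ω))
  simpa using h7

end MeanRatio

/-! ### The geometry of the cylinders -/

namespace MWFractal

variable {N : ℕ} {P : Matrix (Fin N) (Fin N) ℝ} {E : Type*} [NormedAddCommGroup E]
  (F : MWFractal P E)

theorem coding_mem (ω : AdmSeq P) (k : ℕ) : F.coding ω ∈ F.cyl (ω.take (k + 1)) :=
  Set.mem_iInter.1 (F.iInter_cyl_nonempty ω).some_mem k

theorem pathProd_ratio_pos (k : ℕ) (ω : AdmSeq P) : 0 < pathProd F.ratio k ω :=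
  pathProd_pos (fun i j h => (F.ratio_mem i j h).1) k ω

theorem log_pathProd_ratio_nonpos (k : ℕ) (ω : AdmSeq P) :
    Real.log (pathProd F.ratio k ω) ≤ 0 := by
  rw [log_pathProd fun i j h => (F.ratio_mem i j h).1]
  exact Finset.sum_nonpos fun h _ =>
    (Real.log_neg (F.ratio_mem _ _ (ω.2 h)).1 (F.ratio_mem _ _ (ω.2 h)).2).le

/-- Every cylinder is a similar copy of a first-level cylinder, with ratio the path product. -/
theorem exists_similarity (ω : AdmSeq P) (k : ℕ) :
    ∃ f : E → E, (∀ x y, dist (f x) (f y) = pathProd F.ratio k ω * dist x y) ∧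
      F.cyl (ω.take (k + 1)) = f '' F.cyl [ω.1 k] := by
  cases k with
  | zero => exact ⟨id, by simp [pathProd], by simp [AdmSeq.take]⟩
  | succ k =>
    have hne : ω.take (k + 1) ≠ [] := by simp [AdmSeq.take]
    have ha := take_admissible ω (k + 1 + 1)
    rw [take_succ ω (k + 1)] at ha
    obtain ⟨f, hf, he⟩ := F.similar _ _ hne ha
    rw [← take_succ] at he
    rw [← take_succ, wordProd_take] at hf
    exact ⟨f, hf, he⟩

theorem exists_dist_le_pathProd : ∃ D, 0 < D ∧ ∀ (ω : AdmSeq P) (k : ℕ),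
    ∀ x ∈ F.cyl (ω.take (k + 1)), ∀ y ∈ F.cyl (ω.take (k + 1)),
      dist x y ≤ D * pathProd F.ratio k ω := by
  refine ⟨1 + ∑ i, Metric.diam (F.cyl [i]), ?_, fun ω k => ?_⟩
  · have := Finset.sum_nonneg fun i (_ : i ∈ Finset.univ) => Metric.diam_nonneg (s := F.cyl [i])
    linarith
  · obtain ⟨f, hf, he⟩ := F.exists_similarity ω k
    rw [he]
    rintro _ ⟨x, hx, rfl⟩ _ ⟨y, hy, rfl⟩
    rw [hf, mul_comm]
    refine mul_le_mul_of_nonneg_right ?_ (F.pathProd_ratio_pos k ω).le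
    have h1 := Metric.dist_le_diam_of_mem (F.isCompact_one (ω.1 k)).isBounded hx hy
    have h2 : Metric.diam (F.cyl [ω.1 k]) ≤ ∑ i, Metric.diam (F.cyl [i]) :=
      Finset.single_le_sum (f := fun i => Metric.diam (F.cyl [i]))
        (fun i _ => Metric.diam_nonneg) (Finset.mem_univ (ω.1 k))
    linarith

theorem exists_pathProd_le_diam [NormedSpace ℝ E] [Nontrivial E] :
    ∃ δ, 0 < δ ∧ ∀ (ω : AdmSeq P) (k : ℕ),
      δ * pathProd F.ratio k ω ≤ Metric.diam (F.cyl (ω.take (k + 1))) := by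
  have hdiam : ∀ i, 0 < Metric.diam (F.cyl [i]) := by
    intro i
    refine Metric.diam_pos ?_ (F.isCompact_one i).isBounded
    obtain ⟨x, hx⟩ : (interior (F.cyl [i])).Nonempty := by
      rw [← closure_nonempty_iff, F.regular_one]
      exact F.nonempty_one i
    have := Module.punctured_nhds_neBot ℝ E x
    exact (infinite_of_mem_nhds x (isOpen_interior.mem_nhds hx)).nontrivial.mono interior_subset
  obtain ⟨δ, hδ, -, h⟩ := exists_pos_le hdiam
  refine ⟨δ, hδ, fun ω k => ?_⟩
  obtain ⟨f, hf, he⟩ := F.exists_similarity ω k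
  have hc := F.pathProd_ratio_pos k ω
  have h1 : Metric.diam (F.cyl [ω.1 k]) ≤
      Metric.diam (F.cyl (ω.take (k + 1))) / pathProd F.ratio k ω := by
    refine Metric.diam_le_of_forall_dist_le (div_nonneg Metric.diam_nonneg hc.le)
      fun x hx y hy => ?_
    rw [le_div_iff₀' hc, ← hf, he]
    exact Metric.dist_le_diam_of_mem (he ▸ (F.cyl_nonempty_isCompact ω k).2).isBounded
      (Set.mem_image_of_mem f hx) (Set.mem_image_of_mem f hy)
  rw [← le_div_iff₀ hc]
  exact (h _).trans h1

/-- Points of the fractal with different words of length `k + 1` are separated at the scale of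
their cylinders of that length: compare at the first index at which the words differ. -/
theorem exists_separation [NormedSpace ℝ E] [Nontrivial E] (hsep : F.Separated) :
    ∃ κ, 0 < κ ∧ ∀ (ω η : AdmSeq P) (k : ℕ), ω.take (k + 1) ≠ η.take (k + 1) →
      κ * pathProd F.ratio k ω ≤ dist (F.coding ω) (F.coding η) := by
  obtain ⟨t, ht, -, h⟩ := hsep
  obtain ⟨δ, hδ, hdiam⟩ := F.exists_pathProd_le_diam
  refine ⟨t * δ, mul_pos ht hδ, fun ω η k hne => ?_⟩
  have hex : ∃ i, ω.1 i ≠ η.1 i := by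
    by_contra! hall
    exact hne (take_eq_take_iff.2 fun i _ => hall i)
  classical
  set i := Nat.find hex with hi
  have hik : i ≤ k := by
    by_contra! hlt
    exact hne (take_eq_take_iff.2 fun l hl => not_not.1 (Nat.find_min hex (by omega)))
  have hpre : ω.take i = η.take i :=
    take_eq_take_iff.2 fun l hl => not_not.1 (Nat.find_min hex hl)
  have h1 := h (ω.take i) (ω.1 i) (η.1 i) (Nat.find_spec hex)
    (take_succ ω i ▸ take_admissible ω (i + 1))
    (hpre ▸ take_succ η i ▸ take_admissible η (i + 1))
    (F.coding ω) (take_succ ω i ▸ F.coding_mem ω i)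
    (F.coding η) (hpre ▸ take_succ η i ▸ F.coding_mem η i)
  rw [← take_succ] at h1
  refine le_trans ?_ h1
  rw [mul_assoc]
  refine mul_le_mul_of_nonneg_left (le_trans ?_ (le_max_left _ _)) ht.le
  refine le_trans (mul_le_mul_of_nonneg_left ?_ hδ.le) (hdiam ω i)
  exact pathProd_anti (fun a b hab => ⟨(F.ratio_mem a b hab).1, (F.ratio_mem a b hab).2.le⟩) hik ω

theorem continuous_coding : Continuous F.coding := by
  obtain ⟨D, hD, hdist⟩ := F.exists_dist_le_pathProd
  obtain ⟨r, hr0, hr1, hr⟩ := exists_le_lt_one_of_transition (P := P) (a := F.ratio)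
    fun i j h => (F.ratio_mem i j h).2
  refine continuous_iff_continuousAt.2 fun ω => Metric.tendsto_nhds.2 fun ε hε => ?_
  obtain ⟨k, hk⟩ := exists_pow_lt_of_lt_one (div_pos hε hD) hr1
  have hev : ∀ᶠ η in nhds ω, ∀ i ∈ Finset.range (k + 1), η.1 i = ω.1 i := by
    rw [Filter.eventually_all_finset]
    intro i _
    have hcont : Continuous fun η : AdmSeq P => η.1 i :=
      (continuous_apply i).comp continuous_subtype_val
    exact hcont.tendsto ω (mem_nhds_discrete.2 rfl : {ω.1 i} ∈ nhds (ω.1 i))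
  filter_upwards [hev] with η hη
  have htake : η.take (k + 1) = ω.take (k + 1) :=
    take_eq_take_iff.2 fun i hi => hη i (Finset.mem_range.2 hi)
  have h1 := hdist ω k _ (htake ▸ F.coding_mem η k) _ (F.coding_mem ω k)
  have h2 := pathProd_add_le (a := F.ratio) (r := r)
    (fun i j h => ⟨(F.ratio_mem i j h).1, hr i j h⟩) 0 k ω
  simp only [zero_add, pathProd, Finset.range_zero, Finset.prod_empty, mul_one] at h2
  refine (h1.trans (mul_le_mul_of_nonneg_left h2 hD.le)).trans_lt ?_
  rwa [lt_div_iff₀' hD] at hk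

theorem measurable_coding [MeasurableSpace E] [BorelSpace E] : Measurable F.coding :=
  F.continuous_coding.measurable

end MWFractal

/-! ### Norms on a finite-dimensional space -/

section Norms

variable {E : Type*} [NormedAddCommGroup E] [NormedSpace ℝ E] [FiniteDimensional ℝ E]

theorem continuous_seminorm (nm : Seminorm ℝ E) : Continuous nm :=
  nm.convexOn.locallyLipschitz.continuous

theorem exists_seminorm_le (nm : Seminorm ℝ E) : ∃ B, 0 < B ∧ ∀ x, nm x ≤ B * ‖x‖ :=
  nm.bound_of_continuous_normedSpace (continuous_seminorm nm)

theorem exists_le_seminorm (nm : Seminorm ℝ E) (hnm : ∀ x, nm x = 0 → x = 0) :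
    ∃ A, 0 < A ∧ ∀ x, A * ‖x‖ ≤ nm x := by
  rcases subsingleton_or_nontrivial E with h | h
  · exact ⟨1, one_pos, fun x => by simp [Subsingleton.elim x 0]⟩
  obtain ⟨x₀, hx₀, hmin⟩ := (isCompact_sphere (0 : E) 1).exists_isMinOn
    (NormedSpace.sphere_nonempty.2 zero_le_one) (continuous_seminorm nm).continuousOn
  have hne : x₀ ≠ 0 := by
    rintro rfl
    simp at hx₀
  refine ⟨nm x₀, (apply_nonneg nm x₀).lt_of_ne fun h => hne (hnm _ h.symm), fun x => ?_⟩
  rcases eq_or_ne x 0 with rfl | hx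
  · simp
  have hx' : 0 < ‖x‖ := norm_pos_iff.2 hx
  have h1 : nm x₀ ≤ nm (‖x‖⁻¹ • x) := hmin (by simp [norm_smul, hx'.ne'])
  rw [map_smul_eq_mul, norm_inv, norm_norm, le_inv_mul_iff₀ hx', mul_comm] at h1
  exact h1

end Norms

/-! ### Bounds for the mean logarithmic distance -/

theorem ofReal_integral_le_lintegral {Ω : Type*} [MeasurableSpace Ω] {m : Measure Ω} {f : Ω → ℝ}
    (hf : Integrable f m) : ENNReal.ofReal (∫ x, f x ∂m) ≤ ∫⁻ x, ENNReal.ofReal (f x) ∂m := by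
  have h1 : ∫ x, f x ∂m ≤ ∫ x, max (f x) 0 ∂m :=
    integral_mono hf hf.pos_part fun x => le_max_left _ _
  refine (ENNReal.ofReal_le_ofReal h1).trans_eq ?_
  rw [ofReal_integral_eq_lintegral_ofReal hf.pos_part
    (Eventually.of_forall fun x => le_max_right _ _)]
  simp

section DistBounds

variable {E : Type*} [NormedAddCommGroup E] [NormedSpace ℝ E]

/-- A layer-cake bound: `-log y` exceeds `-log r` by at most `-log θ` times the number of the
scales `r θ^k` that are larger than `y`. For `y = 0` both sides are infinite. -/
theorem neg_log_le_tsum {r θ y : ℝ} (hr : 0 < r) (hθ : 0 < θ) (hθ1 : θ < 1) :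
    (-ENNReal.log (ENNReal.ofReal y)).toENNReal ≤ ENNReal.ofReal (-Real.log r) +
      ENNReal.ofReal (-Real.log θ) * ∑' k : ℕ, if y < r * θ ^ k then 1 else 0 := by
  classical
  have hlogθ : 0 < -Real.log θ := neg_pos.2 (Real.log_neg hθ hθ1)
  by_cases hex : ∃ k : ℕ, r * θ ^ k ≤ y
  · set K := Nat.find hex with hK
    have hKy : r * θ ^ K ≤ y := Nat.find_spec hex
    have hy : 0 < y := lt_of_lt_of_le (by positivity) hKy
    have hlog : -Real.log y ≤ -Real.log r + -Real.log θ * K := by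
      have h1 := Real.log_le_log (by positivity) hKy
      rw [Real.log_mul hr.ne' (by positivity), Real.log_pow] at h1
      linarith
    have hcount : (K : ℝ≥0∞) ≤ ∑' k : ℕ, if y < r * θ ^ k then 1 else 0 := by
      refine le_trans (le_of_eq ?_) (ENNReal.sum_le_tsum (Finset.range K))
      have h1 : ∀ k ∈ Finset.range K, (if y < r * θ ^ k then (1 : ℝ≥0∞) else 0) = 1 :=
        fun k hk => if_pos (not_le.1 (Nat.find_min hex (Finset.mem_range.1 hk)))
      rw [Finset.sum_congr rfl h1]
      simp
    rw [ENNReal.log_ofReal_of_pos hy, ← EReal.coe_neg, EReal.real_coe_toENNReal]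
    calc ENNReal.ofReal (-Real.log y) ≤ ENNReal.ofReal (-Real.log r + -Real.log θ * K) :=
          ENNReal.ofReal_le_ofReal hlog
      _ ≤ ENNReal.ofReal (-Real.log r) + ENNReal.ofReal (-Real.log θ * K) :=
          ENNReal.ofReal_add_le
      _ = ENNReal.ofReal (-Real.log r) + ENNReal.ofReal (-Real.log θ) * K := by
          rw [ENNReal.ofReal_mul hlogθ.le, ENNReal.ofReal_natCast]
      _ ≤ _ := by gcongr
  · push Not at hex
    simp only [hex, if_true]
    rw [ENNReal.tsum_const_eq_top_of_ne_zero one_ne_zero,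
      ENNReal.mul_top (by simpa using hlogθ), add_top]
    exact le_top

theorem exists_setDist_eq (nm : Seminorm ℝ E) {α : Finset E} (hα : α.Nonempty) (x : E) :
    ∃ a ∈ α, setDist nm α x = ENNReal.ofReal (nm (x - a)) := by
  obtain ⟨a, ha, hmin⟩ := α.exists_min_image (fun a => ENNReal.ofReal (nm (x - a))) hα
  exact ⟨a, ha, le_antisymm (iInf₂_le a ha) (le_iInf₂ hmin)⟩

theorem measurable_setDist [FiniteDimensional ℝ E] [MeasurableSpace E] [BorelSpace E]
    (nm : Seminorm ℝ E) (α : Finset E) : Measurable (setDist nm α) :=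
  Measurable.biInf _ α.countable_toSet fun _ _ => ((continuous_seminorm nm).comp
    (continuous_id.sub continuous_const)).measurable.ennreal_ofReal

end DistBounds

namespace MWFractal

variable {N : ℕ} {P : Matrix (Fin N) (Fin N) ℝ} {E : Type*} [NormedAddCommGroup E]
  [NormedSpace ℝ E] [FiniteDimensional ℝ E] (F : MWFractal P E) {q : Fin N → ℝ}
  {m : Measure (AdmSeq P)}

/-- The upper bound: one point in each cylinder of the stopping time. These cylinders have mass of
order at least `ε`, so there are at most of order `1 / ε` of them. -/
theorem exists_meanLog_le [MeasurableSpace E] [BorelSpace E] (nm : Seminorm ℝ E)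
    (hP : P ∈ Matrix.rowStochastic ℝ (Fin N)) (hcard : ∀ i, 2 ≤ {j | 0 < P i j}.ncard)
    (hq : ∀ i, 0 < q i) (hq_sum : ∑ i, q i = 1) (hm : IsMarkovMeasure P q m) :
    ∃ K C : ℝ, 1 ≤ K ∧ ∀ ε : ℝ, 0 < ε → ε ≤ 1 → ∃ α : Finset E, 1 ≤ α.card ∧
      (α.card : ℝ) ≤ K / ε ∧ meanLog nm (F.markovTypeMeasure m) α ≤
        ((∫ ω, Real.log (pathProd F.ratio (stopTime ε ω) ω) ∂m + C : ℝ) : EReal) := by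
  classical
  have := isProbabilityMeasure_of_isMarkovMeasure hm hq hq_sum
  obtain ⟨lam, hlam0, hlam1, hlam⟩ := exists_transition_le hP hcard
  obtain ⟨p, hp0, hp1, hp⟩ := exists_pos_le_of_transition (P := P) (a := P) fun i j h => h
  obtain ⟨q₀, hq0, hq1, hq₀⟩ := exists_pos_le hq
  obtain ⟨D, hD, hdist⟩ := F.exists_dist_le_pathProd
  obtain ⟨B, hB, hnorm⟩ := exists_seminorm_le nm
  have hW : 0 ≤ Real.log (1 + B * D) := Real.log_nonneg (by nlinarith [mul_pos hB hD])
  have hW0 : 0 < 1 + B * D := by positivity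
  -- Each stopped cylinder has mass at least `q₀ p ε`.
  refine ⟨(q₀ * p)⁻¹, 2 * Real.log (1 + B * D),
    (one_le_inv₀ (mul_pos hq0 hp0)).2 (mul_le_one₀ hq1 hp0.le hp1), fun ε hε hε1 => ?_⟩
  have hne : Nonempty (AdmSeq P) := nonempty_of_isProbabilityMeasure m
  let T : AdmSeq P → List (Fin N) := fun ω => ω.take (stopTime ε ω + 1)
  have hTeq : ∀ ω η : AdmSeq P, T ω = T η ↔
      ω.take (stopTime ε η + 1) = η.take (stopTime ε η + 1) := by
    intro ω η
    constructor
    · intro h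
      have h1 := congrArg List.length h
      simp only [T, length_take, Nat.add_right_cancel_iff] at h1
      simpa only [T, h1] using h
    · intro h
      have h1 := stopTime_congr hlam hlam1 hε h.symm
      simp only [T, h1, h]
  have hfin : (Set.range T).Finite := by
    obtain ⟨K, hK⟩ := exists_pow_lt_of_lt_one hε hlam1
    refine (List.finite_length_le (Fin N) (K + 1)).subset ?_
    rintro _ ⟨ω, rfl⟩
    have : stopTime ε ω ≤ K := stopTime_le (pathProd_le_of_pow_le hlam hK.le ω)
    simpa [T, length_take] using this
  let R : List (Fin N) → AdmSeq P := Function.invFun T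
  have hR : ∀ ω, T (R (T ω)) = T ω := fun ω => Function.invFun_eq ⟨ω, rfl⟩
  let α : Finset E := hfin.toFinset.image fun σ => F.coding (R σ)
  have hmass : ∀ σ ∈ hfin.toFinset, MeasurableSet (T ⁻¹' {σ}) ∧
      ENNReal.ofReal (q₀ * (p * ε)) ≤ m (T ⁻¹' {σ}) := by
    intro σ hσ
    obtain ⟨η, rfl⟩ := hfin.mem_toFinset.1 hσ
    have h1 : T ⁻¹' {T η} = {ω | ω.take (stopTime ε η + 1) = η.take (stopTime ε η + 1)} := by
      ext ω
      exact hTeq ω η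
    rw [h1, measure_take_eq_take hm]
    refine ⟨measurableSet_take_eq _ _, ENNReal.ofReal_le_ofReal ?_⟩
    exact mul_le_mul (hq₀ _) (mul_le_pathProd_stopTime hp hp0.le hp1 hε1 η) (by positivity)
      (hq _).le
  have hcardα : (α.card : ℝ) ≤ (q₀ * p)⁻¹ / ε := by
    have h1 := sum_measure_le_measure_univ (μ := m) (s := hfin.toFinset)
      (t := fun σ => T ⁻¹' {σ}) (fun σ hσ => (hmass σ hσ).1.nullMeasurableSet) (by
        intro σ _ τ _ hστ
        refine Disjoint.aedisjoint (Set.disjoint_left.2 fun ω h h' => hστ ?_)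
        exact (Eq.symm h).trans h')
    have h2 := (Finset.card_nsmul_le_sum _ _ _ fun σ hσ => (hmass σ hσ).2).trans h1
    rw [measure_univ, nsmul_eq_mul, ← ENNReal.ofReal_natCast,
      ← ENNReal.ofReal_mul (Nat.cast_nonneg _), ENNReal.ofReal_le_one] at h2
    have h3 : (α.card : ℝ) ≤ hfin.toFinset.card := by exact_mod_cast Finset.card_image_le
    rw [div_eq_mul_inv, ← mul_inv, ← one_div, le_div_iff₀ (by positivity), mul_assoc q₀]
    exact (mul_le_mul_of_nonneg_right h3 (by positivity)).trans h2
  obtain ⟨ω₀⟩ := hne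
  have hmem : ∀ ω, F.coding (R (T ω)) ∈ α := fun ω =>
    Finset.mem_image_of_mem _ (hfin.mem_toFinset.2 ⟨ω, rfl⟩)
  refine ⟨α, Finset.card_pos.2 ⟨_, hmem ω₀⟩, hcardα, ?_⟩
  have hlog : ∀ ω, ENNReal.log (setDist nm α (F.coding ω)) ≤
      ((Real.log (pathProd F.ratio (stopTime ε ω) ω) + Real.log (1 + B * D) : ℝ) : EReal) := by
    intro ω
    have hc := F.pathProd_ratio_pos (stopTime ε ω) ω
    have h1 : (R (T ω)).take (stopTime ε ω + 1) = ω.take (stopTime ε ω + 1) :=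
      (hTeq _ _).1 (hR ω)
    have h2 := hdist ω (stopTime ε ω) _ (F.coding_mem ω _) _
      (h1 ▸ F.coding_mem (R (T ω)) (stopTime ε ω))
    have h3 := hnorm (F.coding ω - F.coding (R (T ω)))
    rw [← dist_eq_norm] at h3
    rw [← Real.log_mul hc.ne' hW0.ne', ← ENNReal.log_ofReal_of_pos (mul_pos hc hW0)]
    refine ENNReal.log_le_log ((iInf₂_le _ (hmem ω)).trans (ENNReal.ofReal_le_ofReal ?_))
    nlinarith [mul_le_mul_of_nonneg_left h2 hB.le]
  have hlogint := integrable_log_pathProd_stopTime (m := m) hlam hlam1 hε fun i j h =>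
    (F.ratio_mem i j h).1
  have hmeas := (measurable_setDist nm α).ennreal_log
  have hpos : ∫⁻ x, (ENNReal.log (setDist nm α x)).toENNReal ∂(F.markovTypeMeasure m) ≤
      ENNReal.ofReal (Real.log (1 + B * D)) := by
    rw [markovTypeMeasure, lintegral_map hmeas.ereal_toENNReal F.measurable_coding]
    refine (lintegral_mono fun ω => ?_).trans_eq 
      (by rw [lintegral_const, measure_univ, mul_one] :
        ∫⁻ _, ENNReal.ofReal (Real.log (1 + B * D)) ∂m = _)
    refine (EReal.toENNReal_le_toENNReal (hlog ω)).trans ?_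
    rw [EReal.real_coe_toENNReal]
    refine ENNReal.ofReal_le_ofReal ?_
    linarith [F.log_pathProd_ratio_nonpos (stopTime ε ω) ω]
  have hneg : ENNReal.ofReal (-∫ ω, Real.log (pathProd F.ratio (stopTime ε ω) ω) ∂m -
      Real.log (1 + B * D)) ≤
        ∫⁻ x, (-ENNReal.log (setDist nm α x)).toENNReal ∂(F.markovTypeMeasure m) := by
    have hmeasneg : Measurable fun x => -ENNReal.log (setDist nm α x) := hmeas.neg
    rw [markovTypeMeasure, lintegral_map hmeasneg.ereal_toENNReal F.measurable_coding]
    have h1 : -∫ ω, Real.log (pathProd F.ratio (stopTime ε ω) ω) ∂m - Real.log (1 + B * D) =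
        ∫ ω, (-Real.log (pathProd F.ratio (stopTime ε ω) ω) - Real.log (1 + B * D)) ∂m := by
      rw [integral_sub hlogint.fun_neg (integrable_const _), integral_neg]
      simp
    have hint : Integrable (fun ω : AdmSeq P =>
        -Real.log (pathProd F.ratio (stopTime ε ω) ω) - Real.log (1 + B * D)) m :=
      hlogint.fun_neg.sub (integrable_const _)
    rw [h1]
    refine (ofReal_integral_le_lintegral hint).trans (lintegral_mono fun ω => ?_)
    rw [← EReal.real_coe_toENNReal]
    refine EReal.toENNReal_le_toENNReal ?_
    rw [EReal.le_neg, ← EReal.coe_neg]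
    convert hlog ω using 2
    ring
  calc meanLog nm (F.markovTypeMeasure m) α
      ≤ (ENNReal.ofReal (Real.log (1 + B * D)) : EReal) -
          (ENNReal.ofReal (-∫ ω, Real.log (pathProd F.ratio (stopTime ε ω) ω) ∂m -
            Real.log (1 + B * D)) : EReal) :=
        EReal.sub_le_sub (EReal.coe_ennreal_le_coe_ennreal_iff.2 hpos)
          (EReal.coe_ennreal_le_coe_ennreal_iff.2 hneg)
    _ ≤ ((Real.log (1 + B * D) : ℝ) : EReal) -
          ((-∫ ω, Real.log (pathProd F.ratio (stopTime ε ω) ω) ∂m -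
            Real.log (1 + B * D) : ℝ) : EReal) := by
        rw [EReal.coe_ennreal_ofReal, EReal.coe_ennreal_ofReal, max_eq_left hW]
        exact EReal.sub_le_sub le_rfl (EReal.coe_le_coe_iff.2 (le_max_left _ _))
    _ = _ := by
        rw [← EReal.coe_sub]
        congr 1
        ring

/-- The points of the fractal that are closer to `a` than a small multiple of `θ^k` times the size
of their stopped cylinder all lie in a single cylinder, namely `k` levels below a stopped one. -/
theorem exists_cylinder_of_near [Nontrivial E] (nm : Seminorm ℝ E)
    (hnm : ∀ x, nm x = 0 → x = 0) (hP : P ∈ Matrix.rowStochastic ℝ (Fin N))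
    (hsep : F.Separated) (hq : ∀ i, 0 < q i) (hq_sum : ∑ i, q i = 1)
    (hm : IsMarkovMeasure P q m) {lam θ : ℝ} (hlam : ∀ i j, P i j ≤ lam) (hlam1 : lam < 1)
    (hθ : 0 < θ) (hθc : ∀ i j, 0 < P i j → θ ≤ F.ratio i j) :
    ∃ b, 0 < b ∧ ∀ ε : ℝ, 0 < ε → ∀ (a : E) (k : ℕ), ∃ V : Set (AdmSeq P), MeasurableSet V ∧
      m V ≤ ENNReal.ofReal (lam ^ k * ε) ∧ ∀ ω : AdmSeq P,
        nm (F.coding ω - a) < b * pathProd F.ratio (stopTime ε ω) ω * θ ^ k → ω ∈ V := by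
  obtain ⟨κ, hκ, hdist⟩ := F.exists_separation hsep
  obtain ⟨A, hA, hnorm⟩ := exists_le_seminorm nm hnm
  refine ⟨A * κ / 2, by positivity, fun ε hε a k => ?_⟩
  by_cases hex : ∃ η : AdmSeq P,
      nm (F.coding η - a) < A * κ / 2 * pathProd F.ratio (stopTime ε η) η * θ ^ k
  swap
  · push Not at hex
    exact ⟨∅, MeasurableSet.empty, by simp, fun ω hω => absurd hω (hex ω).not_gt⟩
  obtain ⟨η, hη⟩ := hex
  refine ⟨{ω | ω.take (stopTime ε η + k + 1) = η.take (stopTime ε η + k + 1)},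
    measurableSet_take_eq _ _, ?_, fun ω hω => ?_⟩
  · have hq1 : ∀ i, q i ≤ 1 := fun i => by
      rw [← hq_sum]
      exact Finset.single_le_sum (fun j _ => (hq j).le) (Finset.mem_univ i)
    refine (measure_take_eq_take_le hm hq1 _ η).trans (ENNReal.ofReal_le_ofReal ?_)
    have hlam0 : 0 ≤ lam := (Matrix.nonneg_of_mem_rowStochastic hP).trans (hlam (η.1 0) (η.1 0))
    refine (pathProd_add_le (a := P) (fun i j h => ⟨h, hlam i j⟩) _ k η).trans ?_
    exact mul_le_mul_of_nonneg_left (pathProd_stopTime_le hlam hlam1 hε η) (pow_nonneg hlam0 k)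
  · by_contra hne
    have hne' : ω.take (stopTime ε ω + k + 1) ≠ η.take (stopTime ε ω + k + 1) := by
      intro h
      have h1 := stopTime_congr hlam hlam1 hε
        (take_eq_take_of_le h (by omega : stopTime ε ω + 1 ≤ stopTime ε ω + k + 1))
      rw [← h1] at h
      exact hne h
    have hlow : ∀ ξ : AdmSeq P, θ ^ k * pathProd F.ratio (stopTime ε ξ) ξ ≤
        pathProd F.ratio (stopTime ε ξ + k) ξ := fun ξ =>
      le_pathProd_add hθ.le (fun i j h => ⟨(F.ratio_mem i j h).1, hθc i j h⟩) _ _ ξ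
    have h1 := (mul_le_mul_of_nonneg_left (hlow ω) hκ.le).trans (hdist ω η _ hne')
    have h2 := (mul_le_mul_of_nonneg_left (hlow η) hκ.le).trans
      (hdist η ω _ fun h => hne h.symm)
    rw [dist_comm] at h2
    have h3 := hnorm (F.coding ω - F.coding η)
    rw [← dist_eq_norm] at h3
    have h4 : nm (F.coding ω - F.coding η) ≤ nm (F.coding ω - a) + nm (F.coding η - a) := by
      rw [← sub_sub_sub_cancel_right _ _ a]
      exact map_sub_le_add nm _ _
    nlinarith [mul_le_mul_of_nonneg_left h1 hA.le, mul_le_mul_of_nonneg_left h2 hA.le]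

/-- The lower bound: each point of `α` contributes to the integral of the negative part of
`log d(x, α)` on cylinders of mass `λ^k ε` only, which adds up to order `ε`. -/
theorem exists_le_meanLog [Nontrivial E] [MeasurableSpace E] [BorelSpace E] (nm : Seminorm ℝ E)
    (hnm : ∀ x, nm x = 0 → x = 0)
    (hP : P ∈ Matrix.rowStochastic ℝ (Fin N)) (hcard : ∀ i, 2 ≤ {j | 0 < P i j}.ncard)
    (hsep : F.Separated) (hq : ∀ i, 0 < q i) (hq_sum : ∑ i, q i = 1)
    (hm : IsMarkovMeasure P q m) :
    ∃ C : ℝ, ∀ ε : ℝ, 0 < ε → ∀ α : Finset E, α.Nonempty → α.card * ε ≤ 1 →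
      ((∫ ω, Real.log (pathProd F.ratio (stopTime ε ω) ω) ∂m - C : ℝ) : EReal) ≤
        meanLog nm (F.markovTypeMeasure m) α := by
  classical
  have := isProbabilityMeasure_of_isMarkovMeasure hm hq hq_sum
  obtain ⟨lam, hlam0, hlam1, hlam⟩ := exists_transition_le hP hcard
  obtain ⟨θ', hθ0', hθ1', hθc'⟩ := exists_pos_le_of_transition (P := P) (a := F.ratio)
    fun i j h => (F.ratio_mem i j h).1
  -- The layer-cake bound needs `θ < 1` strictly, which halving provides.
  obtain ⟨θ, hθ0, hθ1, hθc⟩ : ∃ θ, 0 < θ ∧ θ < 1 ∧ ∀ i j, 0 < P i j → θ ≤ F.ratio i j :=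
    ⟨θ' / 2, by linarith, by linarith, fun i j h => by linarith [hθc' i j h]⟩
  obtain ⟨b, hb, hV⟩ := F.exists_cylinder_of_near nm hnm hP hsep hq hq_sum hm hlam hlam1 hθ0 hθc
  have hlogθ : 0 ≤ -Real.log θ := (neg_pos.2 (Real.log_neg hθ0 hθ1)).le
  have hlam1' : 0 < 1 - lam := by linarith
  refine ⟨|Real.log b| + -Real.log θ * (1 - lam)⁻¹, fun ε hε α hα hcardα => ?_⟩
  choose V hVmeas hVle hVmem using hV ε hε
  have hlogint := integrable_log_pathProd_stopTime (m := m) hlam hlam1 hε fun i j h =>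
    (F.ratio_mem i j h).1
  have hlogneg : ∀ ω : AdmSeq P, Real.log (pathProd F.ratio (stopTime ε ω) ω) ≤ 0 :=
    fun ω => F.log_pathProd_ratio_nonpos _ ω
  have hpt : ∀ ω, (-ENNReal.log (setDist nm α (F.coding ω))).toENNReal ≤
      ENNReal.ofReal (-Real.log (pathProd F.ratio (stopTime ε ω) ω) + |Real.log b|) +
        ENNReal.ofReal (-Real.log θ) * ∑' k, ∑ a ∈ α, (V a k).indicator 1 ω := by
    intro ω
    have hc := F.pathProd_ratio_pos (stopTime ε ω) ω
    obtain ⟨a, ha, heq⟩ := exists_setDist_eq nm hα (F.coding ω)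
    rw [heq]
    refine (neg_log_le_tsum (mul_pos hb hc) hθ0 hθ1).trans ?_
    gcongr with k
    · rw [Real.log_mul hb.ne' hc.ne']
      have := neg_abs_le (Real.log b)
      linarith
    · refine le_trans ?_ (Finset.single_le_sum (f := fun a => (V a k).indicator 1 ω)
        (fun _ _ => zero_le) ha)
      split_ifs with h
      · simp [Set.indicator_of_mem (hVmem a k ω h)]
      · exact zero_le
  have hsum : ∫⁻ ω, ∑' k, ∑ a ∈ α, (V a k).indicator 1 ω ∂m ≤ ENNReal.ofReal (1 - lam)⁻¹ := by
    rw [lintegral_tsum fun k => (Finset.measurable_fun_sum _ fun a _ =>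
      measurable_one.indicator (hVmeas a k)).aemeasurable]
    calc ∑' k, ∫⁻ ω, ∑ a ∈ α, (V a k).indicator 1 ω ∂m
        ≤ ∑' k, ENNReal.ofReal (lam ^ k) := by
          refine ENNReal.tsum_le_tsum fun k => ?_
          rw [lintegral_finsetSum _ fun a _ => measurable_one.indicator (hVmeas a k)]
          simp only [lintegral_indicator_one (hVmeas _ k)]
          refine (Finset.sum_le_card_nsmul _ _ _ fun a _ => hVle a k).trans ?_
          rw [nsmul_eq_mul, ← ENNReal.ofReal_natCast, ← ENNReal.ofReal_mul (Nat.cast_nonneg _)]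
          refine ENNReal.ofReal_le_ofReal ?_
          nlinarith [mul_le_mul_of_nonneg_left hcardα (pow_nonneg hlam0 k)]
      _ = ENNReal.ofReal (1 - lam)⁻¹ := by
          rw [← ENNReal.ofReal_tsum_of_nonneg (fun k => pow_nonneg hlam0 k)
            (summable_geometric_of_lt_one hlam0 hlam1), tsum_geometric_of_lt_one hlam0 hlam1]
  have hneg : ∫⁻ x, (-ENNReal.log (setDist nm α x)).toENNReal ∂(F.markovTypeMeasure m) ≤
      ENNReal.ofReal (-∫ ω, Real.log (pathProd F.ratio (stopTime ε ω) ω) ∂m +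
        (|Real.log b| + -Real.log θ * (1 - lam)⁻¹)) := by
    refine (lintegral_map_le _ _).trans ((lintegral_mono hpt).trans ?_)
    have hmeas : Measurable fun ω => ∑' k, ∑ a ∈ α, (V a k).indicator (1 : AdmSeq P → ℝ≥0∞) ω :=
      Measurable.tsum fun k => Finset.measurable_fun_sum _ fun a _ =>
        measurable_one.indicator (hVmeas a k)
    rw [lintegral_add_right _ (hmeas.const_mul _), lintegral_const_mul _ hmeas]
    have hint2 : Integrable (fun ω : AdmSeq P =>
        -Real.log (pathProd F.ratio (stopTime ε ω) ω) + |Real.log b|) m :=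
      hlogint.fun_neg.add (integrable_const _)
    have hnn : ∀ ω : AdmSeq P,
        0 ≤ -Real.log (pathProd F.ratio (stopTime ε ω) ω) + |Real.log b| := fun ω =>
      add_nonneg (neg_nonneg.2 (hlogneg ω)) (abs_nonneg _)
    rw [← ofReal_integral_eq_lintegral_ofReal hint2 (Eventually.of_forall hnn)]
    refine (add_le_add_right (mul_le_mul_right hsum _) _).trans ?_
    rw [← ENNReal.ofReal_mul hlogθ, ← ENNReal.ofReal_add (integral_nonneg hnn)
      (mul_nonneg hlogθ (inv_nonneg.2 hlam1'.le)),
      integral_add hlogint.fun_neg (integrable_const _), integral_neg]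
    simp [add_assoc]
  have hI : 0 ≤ -∫ ω, Real.log (pathProd F.ratio (stopTime ε ω) ω) ∂m +
      (|Real.log b| + -Real.log θ * (1 - lam)⁻¹) :=
    add_nonneg (neg_nonneg.2 (integral_nonpos hlogneg))
      (add_nonneg (abs_nonneg _) (mul_nonneg hlogθ (inv_nonneg.2 hlam1'.le)))
  calc ((∫ ω, Real.log (pathProd F.ratio (stopTime ε ω) ω) ∂m -
        (|Real.log b| + -Real.log θ * (1 - lam)⁻¹) : ℝ) : EReal)
      = 0 - (ENNReal.ofReal (-∫ ω, Real.log (pathProd F.ratio (stopTime ε ω) ω) ∂m +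
        (|Real.log b| + -Real.log θ * (1 - lam)⁻¹)) : EReal) := by
        rw [EReal.coe_ennreal_ofReal, max_eq_left hI, zero_sub, ← EReal.coe_neg]
        congr 1
        ring
    _ ≤ meanLog nm (F.markovTypeMeasure m) α :=
        EReal.sub_le_sub (EReal.coe_ennreal_nonneg _)
          (EReal.coe_ennreal_le_coe_ennreal_iff.2 hneg)

/-- The geometric mean error is of the exact order `n ^ (-1 / s₀)`. -/
theorem exists_geomError_bounds [Nontrivial E] [MeasurableSpace E] [BorelSpace E]
    (nm : Seminorm ℝ E) (hnm : ∀ x, nm x = 0 → x = 0) (hP : P ∈ Matrix.rowStochastic ℝ (Fin N))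
    (hirr : P.IsIrreducible) (hcard : ∀ i, 2 ≤ {j | 0 < P i j}.ncard) (hsep : F.Separated)
    {v : Fin N → ℝ} (hv_pos : ∀ i, 0 < v i) (hv_sum : ∑ i, v i = 1)
    (hv_eig : Matrix.vecMul v P = v) (hq : ∀ i, 0 < q i) (hq_sum : ∑ i, q i = 1)
    (hm : IsMarkovMeasure P q m) :
    ∃ C : ℝ, ∀ᶠ n : ℕ in atTop,
      EReal.exp ((-(1 / sZero P F.ratio v * Real.log n) - C : ℝ) : EReal) ≤
        geomError nm (F.markovTypeMeasure m) n ∧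
      geomError nm (F.markovTypeMeasure m) n ≤
        EReal.exp ((-(1 / sZero P F.ratio v * Real.log n) + C : ℝ) : EReal) := by
  have hs := sZero_pos hP hcard hv_pos hv_sum F.ratio_mem
  obtain ⟨C₀, hC₀⟩ := exists_integral_log_pathProd_bound hP hirr hcard hv_pos hv_sum hv_eig
    F.ratio_mem
  obtain ⟨K, C₁, hK, hupper⟩ := F.exists_meanLog_le nm hP hcard hq hq_sum hm
  obtain ⟨C₂, hlower⟩ := F.exists_le_meanLog nm hnm hP hcard hsep hq hq_sum hm
  set s := sZero P F.ratio v
  have hI : ∀ ε : ℝ, 0 < ε → ε ≤ 1 →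
      1 / s * Real.log ε - C₀ / s ≤ ∫ ω, Real.log (pathProd F.ratio (stopTime ε ω) ω) ∂m ∧
      ∫ ω, Real.log (pathProd F.ratio (stopTime ε ω) ω) ∂m ≤ 1 / s * Real.log ε + C₀ / s := by
    intro ε hε hε1
    have h := abs_le.1 (hC₀ q m hq hq_sum hm ε hε hε1)
    rw [one_div_mul_eq_div, ← sub_div, ← add_div, div_le_iff₀' hs, le_div_iff₀' hs]
    constructor <;> linarith
  refine ⟨max (C₀ / s + C₂) (1 / s * Real.log K + C₀ / s + C₁), ?_⟩
  filter_upwards [eventually_ge_atTop 1, eventually_ge_atTop ⌈K⌉₊] with n hn hnK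
  have hn0 : (0 : ℝ) < n := by exact_mod_cast hn
  have hnK' : K ≤ n := Nat.ceil_le.1 hnK
  have hK0 : 0 < K := one_pos.trans_le hK
  constructor
  · refine le_iInf₂ fun α hα => EReal.exp_monotone ?_
    have hn1 : (1 : ℝ) ≤ n := by exact_mod_cast hn
    have hε1 : (n : ℝ)⁻¹ ≤ 1 := inv_le_one_of_one_le₀ hn1
    have h1 := hlower (n : ℝ)⁻¹ (by positivity) α (Finset.card_pos.1 hα.1) (by
      rw [← div_eq_mul_inv, div_le_one hn0]
      exact_mod_cast hα.2)
    refine le_trans (EReal.coe_le_coe_iff.2 ?_) h1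
    have h2 := (hI (n : ℝ)⁻¹ (by positivity) hε1).1
    rw [Real.log_inv] at h2
    have h3 := le_max_left (C₀ / s + C₂) (1 / s * Real.log K + C₀ / s + C₁)
    linarith
  -- For `ε = K / n` the bound `K / ε` on the number of points is `n`.
  · have hε1 : K / n ≤ 1 := (div_le_one hn0).2 hnK'
    obtain ⟨α, hα1, hα2, hα3⟩ := hupper (K / n) (by positivity) hε1
    rw [div_div_cancel₀ hK0.ne'] at hα2
    refine (iInf₂_le α ⟨hα1, by exact_mod_cast hα2⟩).trans (EReal.exp_monotone (hα3.trans ?_))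
    refine EReal.coe_le_coe_iff.2 ?_
    have h2 := (hI (K / n) (by positivity) hε1).2
    rw [Real.log_div hK0.ne' hn0.ne'] at h2
    have h3 := le_max_right (C₀ / s + C₂) (1 / s * Real.log K + C₀ / s + C₁)
    linarith

end MWFractal

/-! ### From error bounds to dimension and coefficients -/

section Asymptotics

theorem tendsto_log_div_of_bounds {e : ℕ → ℝ≥0∞} {s C : ℝ} (hs : 0 < s)
    (h : ∀ᶠ n : ℕ in atTop, EReal.exp ((-(1 / s * Real.log n) - C : ℝ) : EReal) ≤ e n ∧
      e n ≤ EReal.exp ((-(1 / s * Real.log n) + C : ℝ) : EReal)) :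
    Tendsto (fun n : ℕ => ((Real.log n : ℝ) : EReal) / (-ENNReal.log (e n))) atTop
      (nhds (s : EReal)) := by
  let x : ℕ → ℝ := fun n => (-ENNReal.log (e n)).toReal
  have hx : ∀ᶠ n : ℕ in atTop, -ENNReal.log (e n) = (x n : EReal) ∧
      |x n - 1 / s * Real.log n| ≤ C := by
    filter_upwards [h] with n hn
    have h1 := ENNReal.log_le_log hn.1
    have h2 := ENNReal.log_le_log hn.2
    rw [EReal.log_exp] at h1 h2
    have h3 : ENNReal.log (e n) ≠ ⊥ := ne_bot_of_le_ne_bot (EReal.coe_ne_bot _) h1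
    have h4 : ENNReal.log (e n) ≠ ⊤ := ne_top_of_le_ne_top (EReal.coe_ne_top _) h2
    obtain ⟨y, hy⟩ : ∃ y : ℝ, ENNReal.log (e n) = y := ⟨_, (EReal.coe_toReal h4 h3).symm⟩
    simp only [x, hy] at h1 h2 ⊢
    rw [EReal.coe_le_coe_iff] at h1 h2
    refine ⟨by rw [← EReal.coe_neg, EReal.toReal_coe], ?_⟩
    rw [← EReal.coe_neg, EReal.toReal_coe, abs_le]
    constructor <;> linarith
  have hlog : Tendsto (fun n : ℕ => Real.log n) atTop atTop :=
    Real.tendsto_log_atTop.comp tendsto_natCast_atTop_atTop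
  have hratio : Tendsto (fun n : ℕ => x n / Real.log n) atTop (nhds (1 / s)) := by
    rw [tendsto_iff_norm_sub_tendsto_zero]
    refine squeeze_zero' (Eventually.of_forall fun _ => norm_nonneg _) ?_
      (hlog.const_div_atTop C)
    filter_upwards [hx, hlog.eventually_gt_atTop 0] with n hn hpos
    have h1 : x n / Real.log n - 1 / s = (x n - 1 / s * Real.log n) / Real.log n := by
      field_simp
    rw [h1, norm_div, Real.norm_eq_abs, Real.norm_of_nonneg hpos.le]
    exact div_le_div_of_nonneg_right hn.2 hpos.le
  have hinv := hratio.inv₀ (by positivity)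
  simp only [inv_div, div_one] at hinv
  refine ((continuous_coe_real_ereal.tendsto s).comp hinv).congr' ?_
  filter_upwards [hx] with n hn
  rw [hn.1, ← EReal.coe_div]
  rfl

theorem natCast_rpow_mul_exp {n : ℕ} (hn : 0 < n) (s C : ℝ) :
    (n : ℝ≥0∞) ^ (1 / s) * EReal.exp ((-(1 / s * Real.log n) + C : ℝ) : EReal) =
      ENNReal.ofReal (Real.exp C) := by
  have hn' : (0 : ℝ) < n := by exact_mod_cast hn
  rw [EReal.exp_coe, ← ENNReal.ofReal_natCast, ENNReal.ofReal_rpow_of_pos hn',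
    Real.rpow_def_of_pos hn', ← ENNReal.ofReal_mul (Real.exp_pos _).le, ← Real.exp_add]
  congr 2
  ring

end Asymptotics

end GeoQuant

open GeoQuant in
theorem theorem1 {E : Type*} [NormedAddCommGroup E] [NormedSpace ℝ E] [FiniteDimensional ℝ E]
    [Nontrivial E] [MeasurableSpace E] [BorelSpace E]
    (nm : Seminorm ℝ E) (hnm : ∀ x, nm x = 0 → x = 0)
    {N : ℕ} (P : Matrix (Fin N) (Fin N) ℝ) (hP : P ∈ Matrix.rowStochastic ℝ (Fin N))
    (hirr : P.IsIrreducible)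
    (hcard : ∀ i, 2 ≤ {j | 0 < P i j}.ncard)
    (F : MWFractal P E) (hsep : F.Separated)
    (v : Fin N → ℝ) (hv_pos : ∀ i, 0 < v i) (hv_sum : ∑ i, v i = 1)
    (hv_eig : Matrix.vecMul v P = v) :
    (∀ q : Fin N → ℝ, (∀ i, 0 < q i) → ∑ i, q i = 1 →
      ∀ m : Measure (AdmSeq P), IsMarkovMeasure P q m →
        lowerDim nm (F.markovTypeMeasure m) = (sZero P F.ratio v : EReal) ∧
        upperDim nm (F.markovTypeMeasure m) = (sZero P F.ratio v : EReal) ∧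
        0 < lowerCoeff nm (sZero P F.ratio v) (F.markovTypeMeasure m) ∧
        lowerCoeff nm (sZero P F.ratio v) (F.markovTypeMeasure m) ≤
          upperCoeff nm (sZero P F.ratio v) (F.markovTypeMeasure m) ∧
        upperCoeff nm (sZero P F.ratio v) (F.markovTypeMeasure m) < ⊤) ∧
    (∀ q q' : Fin N → ℝ, (∀ i, 0 < q i) → ∑ i, q i = 1 → (∀ i, 0 < q' i) → ∑ i, q' i = 1 →
      ∀ m m' : Measure (AdmSeq P), IsMarkovMeasure P q m → IsMarkovMeasure P q' m' →
        lowerDim nm (F.markovTypeMeasure m) = lowerDim nm (F.markovTypeMeasure m') ∧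
        upperDim nm (F.markovTypeMeasure m) = upperDim nm (F.markovTypeMeasure m')) := by
  have hs := sZero_pos hP hcard hv_pos hv_sum F.ratio_mem
  have hdim : ∀ q : Fin N → ℝ, (∀ i, 0 < q i) → ∑ i, q i = 1 →
      ∀ m : Measure (AdmSeq P), IsMarkovMeasure P q m →
        lowerDim nm (F.markovTypeMeasure m) = (sZero P F.ratio v : EReal) ∧
        upperDim nm (F.markovTypeMeasure m) = (sZero P F.ratio v : EReal) := by
    intro q hq hq_sum m hm
    obtain ⟨C, hC⟩ := F.exists_geomError_bounds nm hnm hP hirr hcard hsep hv_pos hv_sum hv_eig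
      hq hq_sum hm
    have ht := tendsto_log_div_of_bounds hs hC
    exact ⟨ht.liminf_eq, ht.limsup_eq⟩
  refine ⟨fun q hq hq_sum m hm => ?_, fun q q' hq hq_sum hq' hq_sum' m m' hm hm' => ?_⟩
  · obtain ⟨C, hC⟩ := F.exists_geomError_bounds nm hnm hP hirr hcard hsep hv_pos hv_sum hv_eig
      hq hq_sum hm
    refine ⟨(hdim q hq hq_sum m hm).1, (hdim q hq hq_sum m hm).2, ?_, liminf_le_limsup, ?_⟩
    · refine lt_of_lt_of_le (ENNReal.ofReal_pos.2 (Real.exp_pos (-C))) (le_liminf_of_le ?_ ?_)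
      · isBoundedDefault
      filter_upwards [hC, eventually_gt_atTop 0] with n hn hpos
      rw [← natCast_rpow_mul_exp hpos (sZero P F.ratio v) (-C), ← sub_eq_add_neg]
      exact mul_le_mul_right hn.1 _
    · refine lt_of_le_of_lt (limsup_le_of_le ?_ ?_) (ENNReal.ofReal_lt_top (r := Real.exp C))
      · isBoundedDefault
      filter_upwards [hC, eventually_gt_atTop 0] with n hn hpos
      rw [← natCast_rpow_mul_exp hpos (sZero P F.ratio v) C]
      exact mul_le_mul_right hn.2 _
  · have h := hdim q hq hq_sum m hm
    have h' := hdim q' hq' hq_sum' m' hm'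
    exact ⟨h.1.trans h'.1.symm, h.2.trans h'.2.symm⟩
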